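/- Let $d\ge 1$ and let $\varphi\in C_c^\infty(B_1)$, $B_1\subset\mathbb R^d$ the unit ball, with $\varphi\ge 0$ and $\int\varphi=1$; put $\varphi_\varepsilon(y)=\varepsilon^{-d}\varphi(y/\varepsilon)$. Let $-\infty\le S<T\le\infty$ and let $u:(S,T)\times\mathbb R^d\to\mathbb R^d$ satisfy $u\in L^1_{\mathrm{loc}}(S,T;\dot W^{1,r}(\mathbb R^d))$ for some $1\le r\le\infty$; that is, $u$ is locally integrable in space-time and its spatial weak gradient $\nabla u$ satisfies $\int_a^b\|\nabla u(t)\|_{L^r(\mathbb R^d)}\,dt<\infty$ for all $[a,b]\subset(S,T)$. For $\varepsilon>0$ let $u_\varepsilon(t,\cdot)=u(t,\cdot)*\varphi_\varepsilon$, and for $t\in(S,T)$, $x\in\mathbb R^d$ let $X_\varepsilon(t,x;\cdot)$ be the unique (Carathéodory) solution on $(S,T)$ of $$\dot X_\varepsilon(t,x;s)=u_\varepsilon(s,X_\varepsilon(t,x;s)),\qquad X_\varepsilon(t,x;t)=x .$$ The skewed parabolic cylinder with center $(t,x)$ and radius $\varepsilon$ is $$Q_\varepsilon(t,x)=\{(s,y):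 |s-t|<\varepsilon^2,\ |y-X_\varepsilon(t,x;s)|<\varepsilon\}.$$ Let $\mathcal M g(x)=\sup_{r>0}\frac1{|B_r|}\int_{B_r(x)}|g|$ be the spatial Hardy–Littlewood maximal function, where $|\nabla u|$ is the operator norm. For $\eta>0$, $Q_\varepsilon(t,x)$ is $\eta$-admissible if $(t-\varepsilon^2,t+\varepsilon^2)\subset(S,T)$ and $$\varepsilon^2\,\frac1{|Q_\varepsilon(t,x)|}\int_{Q_\varepsilon(t,x)}\mathcal M(|\nabla u|)\,dy\,ds<\eta .$$ For $(t,x)\in(S,T)\times\mathbb R^d$ define $$\mathcal M_{\mathcal Q}f(t,x)=\sup\Big\{\frac1{|Q_\varepsilon(t,x)|}\int_{Q_\varepsilon(t,x)}|f|\,dy\,ds:\ \varepsilon>0,\ Q_\varepsilon(t,x)\ \eta\text{-admissible}\Big\}\in[0,\infty]$$ (with $\sup\varnothing=0$). **Theorem.** There are $\eta_0>0$ and $C_1$ depending only on $\varphi$ and $d$, and constants $C_p$, $1<p\le\infty$, depending only on $\varphi,d,p$, such that the following holds for all $0<\eta<\eta_0$ and all $S,T,u$ as above. If $\operatorname{div}u=0$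 and $\mathcal M(|\nabla u|)\in L^q((S,T)\times\mathbb R^d)$ for some $1\le q\le\infty$, then, with all norms taken over $(S,T)\times\mathbb R^d$, $\mathcal M_{\mathcal Q}f$ is Lebesgue measurable for every $f\in L^p$, $1\le p\le\infty$, and: 1. (strong type $(\infty,\infty)$) $\|\mathcal M_{\mathcal Q}f\|_{L^\infty}\le\|f\|_{L^\infty}$ for all $f\in L^\infty$; 2. (weak type $(1,1)$) $|\{(t,x)\in(S,T)\times\mathbb R^d:\mathcal M_{\mathcal Q}f(t,x)>\lambda\}|\le\frac{C_1}{\lambda}\|f\|_{L^1}$ for all $f\in L^1$ and $\lambda>0$; 3. (strong type $(p,p)$) $\|\mathcal M_{\mathcal Q}f\|_{L^p}\le C_p\|f\|_{L^p}$ for all $1<p\le\infty$ and $f\in L^p$. -/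

import Mathlib

open MeasureTheory Set Filter
open scoped ENNReal NNReal Convolution

noncomputable section

namespace SkewedCylinder

/-- Euclidean space `ℝ^d`. -/
abbrev Space (d : ℕ) : Type := EuclideanSpace ℝ (Fin d)

variable {d : ℕ}

/-- The open time interval `(S, T)`, with finite or infinite endpoints. -/
def timeInterval (S T : EReal) : Set ℝ := {t : ℝ | S < (t : EReal) ∧ (t : EReal) < T}

/-- The space-time domain `(S, T) × ℝ^d`. -/
def slab (d : ℕ) (S T : EReal) : Set (ℝ × Space d) := timeInterval S T ×ˢ univ

/-- `φ ∈ C_c^∞(B_1)`, `φ ≥ 0`, `∫ φ = 1`. -/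
structure IsMollifier (φ : Space d → ℝ) : Prop where
  smooth : ContDiff ℝ (⊤ : ℕ∞) φ
  support_subset : tsupport φ ⊆ Metric.ball 0 1
  nonneg : ∀ x, 0 ≤ φ x
  integral_eq_one : ∫ x, φ x = 1

/-- The rescaled mollifier `φ_ε = ε^{-d} φ(· / ε)`. -/
def mollifier (φ : Space d → ℝ) (ε : ℝ) (y : Space d) : ℝ := (ε ^ d)⁻¹ * φ (ε⁻¹ • y)

/-- The mollified velocity `u_ε(t, x) = ∫ φ_ε(y) u(t, x - y) dy`. -/
def mollifiedVelocity (φ : Space d → ℝ) (u : ℝ → Space d → Space d) (ε t : ℝ) (x : Space d) :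
    Space d :=
  (mollifier φ ε ⋆[ContinuousLinearMap.lsmul ℝ ℝ, volume] u t) x

/-- `A` is the weak gradient of the vector field `w` on `ℝ^d`:
`∫ (∂_v ψ) w = - ∫ ψ A v` for all test functions `ψ ∈ C_c^∞(ℝ^d)` and directions `v`. -/
structure IsWeakGradient (w : Space d → Space d) (A : Space d → Space d →L[ℝ] Space d) :
    Prop where
  locallyIntegrable : LocallyIntegrable w volume
  locallyIntegrable_grad : LocallyIntegrable A volume
  integral_eq : ∀ ψ : Space d → ℝ, ContDiff ℝ (⊤ : ℕ∞) ψ → HasCompactSupport ψ → ∀ v : Space d,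
    ∫ x, fderiv ℝ ψ x v • w x = - ∫ x, ψ x • A x v

/-- `u ∈ L^1_loc(S, T; Ẇ^{1,p}(ℝ^d))`, with spatial weak gradient `∇u = G`.
The space `Ẇ^{1,p}` consists of functions, so `u` is locally integrable in space-time. -/
structure MemL1LocHomSobolev (S T : EReal) (p : ℝ≥0∞) (u : ℝ → Space d → Space d)
    (G : ℝ → Space d → Space d →L[ℝ] Space d) : Prop where
  locallyIntegrable : LocallyIntegrableOn (fun z : ℝ × Space d => u z.1 z.2) (slab d S T) volume
  aestronglyMeasurable_grad :
    AEStronglyMeasurable (fun z : ℝ × Space d => G z.1 z.2) (volume.restrict (slab d S T))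
  isWeakGradient : ∀ᵐ t ∂(volume.restrict (timeInterval S T)), IsWeakGradient (u t) (G t)
  lintegral_lt_top : ∀ a b : ℝ, Icc a b ⊆ timeInterval S T →
    ∫⁻ t in Icc a b, eLpNorm (G t) p volume < ∞

/-- The field with spatial gradient `G` is divergence-free: `tr ∇u = 0` almost everywhere. -/
def DivergenceFree (S T : EReal) (G : ℝ → Space d → Space d →L[ℝ] Space d) : Prop :=
  ∀ᵐ t ∂(volume.restrict (timeInterval S T)), ∀ᵐ x : Space d,
    LinearMap.trace ℝ (Space d) (G t x : Space d →ₗ[ℝ] Space d) = 0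

/-- The spatial Hardy-Littlewood maximal function (centered balls). -/
def spatialMaximal {F : Type*} [NormedAddCommGroup F] (g : Space d → F) (x : Space d) : ℝ≥0∞ :=
  ⨆ (r : ℝ) (_ : 0 < r), laverage (volume.restrict (Metric.ball x r)) fun y => ‖g y‖ₑ

/-- `γ` solves `γ' = u_ε(s, γ(s))`, `γ(t) = x` on `(S, T)` in the sense of Carathéodory
(the velocity is only integrable in time), that is, in integrated form. -/
def IsMollifiedTrajectory (φ : Space d → ℝ) (S T : EReal) (u : ℝ → Space d → Space d)
    (ε t : ℝ) (x : Space d) (γ : ℝ → Space d) : Prop :=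
  ∀ s ∈ timeInterval S T,
    IntervalIntegrable (fun τ => mollifiedVelocity φ u ε τ (γ τ)) volume t s ∧
    γ s = x + ∫ τ in t..s, mollifiedVelocity φ u ε τ (γ τ)

/-- The mollified flow `X_ε(t, x; ·)`: the solution of the initial value problem above. For `u` in
`L^1_loc(S, T; Ẇ^{1,p})` and `t ∈ (S, T)` the solution exists and is unique on `(S, T)`. -/
def mollifiedFlow (φ : Space d → ℝ) (S T : EReal) (u : ℝ → Space d → Space d)
    (ε t : ℝ) (x : Space d) : ℝ → Space d :=
  Classical.epsilon (IsMollifiedTrajectory φ S T u ε t x)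

/-- The skewed parabolic cylinder `Q_ε(t, x)`. -/
def cylinder (φ : Space d → ℝ) (S T : EReal) (u : ℝ → Space d → Space d)
    (ε : ℝ) (z : ℝ × Space d) : Set (ℝ × Space d) :=
  {w | |w.1 - z.1| < ε ^ 2 ∧ ‖w.2 - mollifiedFlow φ S T u ε z.1 z.2 w.1‖ < ε}

/-- `Q_ε(t, x)` is `η`-admissible: it lives within the time horizon `(S, T)`, and
`ε² ⨍_{Q_ε(t, x)} M(|∇u|) < η`. -/
def IsAdmissible (φ : Space d → ℝ) (S T : EReal) (u : ℝ → Space d → Space d)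
    (G : ℝ → Space d → Space d →L[ℝ] Space d) (η ε : ℝ) (z : ℝ × Space d) : Prop :=
  Ioo (z.1 - ε ^ 2) (z.1 + ε ^ 2) ⊆ timeInterval S T ∧
  ENNReal.ofReal (ε ^ 2) *
    laverage (volume.restrict (cylinder φ S T u ε z)) (fun w => spatialMaximal (G w.1) w.2)
    < ENNReal.ofReal η

/-- The maximal function `M_Q f` over `η`-admissible cylinders; the supremum over no cylinders
is `0`. -/
def cylinderMaximal (φ : Space d → ℝ) (S T : EReal) (u : ℝ → Space d → Space d)
    (G : ℝ → Space d → Space d →L[ℝ] Space d) (η : ℝ) (f : ℝ × Space d → ℝ)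
    (z : ℝ × Space d) : ℝ≥0∞ :=
  ⨆ (ε : ℝ) (_ : 0 < ε) (_ : IsAdmissible φ S T u G η ε z),
    laverage (volume.restrict (cylinder φ S T u ε z)) fun w => ‖f w‖ₑ

end SkewedCylinder

end

/-! Cylinders of different radii follow different velocities, so they are not comparable a priori,
and two that meet may separate once the shorter lifespan is over. The tool against this is
`IsMollifier.exists_mollification_sub_le`. The derivative of `(ρ, x) ↦ (φ_ρ * w)(x)` is a weighted
integral of `∇w` over `B_ρ(x)`. Hence `|u_ρ(x) - u_ρ'(x')|` is at most a constant times `|ρ - ρ'|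
M|∇u|(y) + |x - x'| M|∇u|(y')`, where `y`, `y'` may be any points within a few radii. This is
averaged over `y` and `y'` in the slices of two admissible cylinders, where admissibility bounds the
time integral of the slice means by `2η`. For small `η`, two center curves a few radii apart change
their separation by less than a quarter of a radius during their common lifespan
(`IsTameCurve.norm_sub_sub_lt`).

For the weak type bound, Vitali selection gives disjoint cylinders such that every cylinder of the
family meets a selected one of at least half its radius. The cylinders meeting a selected `Q` need
not lie in a dilate of `Q`, but their union still has measure comparable to `|Q|`. At a time `τ`,
thin the slices to disjoint balls and follow their centers back to the time of the closed lifespan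
of `Q` nearest to `τ`. There the quarter balls are still disjoint, and all of them lie in one ball
of radius comparable to that of `Q` (`IsTameCurve.volume_iUnion_slice_le`). Integration in time
finishes the count.

Measurability comes from lower semicontinuity. If an admissible cylinder at `z` has a large average,
then so have nearby cylinders of slightly smaller radius, because the averages are continuous
(`IsTameCurve.tendsto_lintegral_tube`). The strong type bounds follow by interpolation with the
trivial `L^∞` estimate. -/

namespace SkewedCylinder

open Metric Topology

/-! ### Derivatives of mollifications in scale and position -/

section Mollifier

variable {d : ℕ} {φ : Space d → ℝ}

lemma IsMollifier.eq_zero_of_one_le (hφ : IsMollifier φ) {y : Space d} (hy : 1 ≤ ‖y‖) :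
    φ y = 0 := by
  by_contra h
  have := hφ.support_subset (subset_tsupport φ h)
  rw [mem_ball_zero_iff] at this
  linarith

lemma IsMollifier.hasCompactSupport (hφ : IsMollifier φ) : HasCompactSupport φ :=
  HasCompactSupport.intro (isCompact_closedBall (0 : Space d) 1) fun x hx =>
    hφ.eq_zero_of_one_le (by
      rw [mem_closedBall_zero_iff, not_le] at hx
      exact hx.le)

lemma IsMollifier.exists_bound (hφ : IsMollifier φ) : ∃ K : ℝ≥0, ∀ x, ‖φ x‖ ≤ K := by
  obtain ⟨K, hK⟩ := hφ.hasCompactSupport.exists_bound_of_continuous hφ.smooth.continuous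
  exact ⟨K.toNNReal, fun x => (hK x).trans (Real.le_coe_toNNReal K)⟩

lemma mollifier_eq_zero (hφ : IsMollifier φ) {ρ : ℝ} (hρ : 0 < ρ) {y : Space d}
    (hy : ρ ≤ ‖y‖) : mollifier φ ρ y = 0 := by
  rw [mollifier, hφ.eq_zero_of_one_le, mul_zero]
  rw [norm_smul, norm_inv, Real.norm_of_nonneg hρ.le, ← div_eq_inv_mul]
  exact (one_le_div hρ).2 hy

lemma norm_mollifier_le {K : ℝ≥0} (hK : ∀ x, ‖φ x‖ ≤ K) {ρ : ℝ} (hρ : 0 < ρ) (y : Space d) :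
    ‖mollifier φ ρ y‖ ≤ (ρ ^ d)⁻¹ * K := by
  rw [mollifier, norm_mul, Real.norm_of_nonneg (by positivity)]
  gcongr
  exact hK _

lemma contDiff_mollifier (hφ : IsMollifier φ) (ρ : ℝ) : ContDiff ℝ (⊤ : ℕ∞) (mollifier φ ρ) :=
  contDiff_const.mul (hφ.smooth.comp (contDiff_const_smul ρ⁻¹))

lemma contDiffOn_uncurry_mollifier (hφ : IsMollifier φ) :
    ContDiffOn ℝ 1 ↿(mollifier φ) (Ioi 0 ×ˢ univ) := by
  have h1 : ContDiffOn ℝ 1 (fun q : ℝ × Space d => (q.1 ^ d)⁻¹) (Ioi 0 ×ˢ univ) :=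
    (contDiffOn_fst.pow d).inv fun q hq => (pow_pos hq.1 d).ne'
  have h2 : ContDiffOn ℝ 1 (fun q : ℝ × Space d => q.1⁻¹ • q.2) (Ioi 0 ×ˢ univ) :=
    (contDiffOn_fst.inv fun q hq => (show (0 : ℝ) < q.1 from hq.1).ne').smul contDiffOn_snd
  exact h1.mul ((hφ.smooth.of_le (by exact_mod_cast le_top)).comp_contDiffOn h2)

/-- Enlarging the scale moves the kernel along the radial field `-y / ρ` and corrects its mass. In
this shape the derivative can be recognised as a divergence. -/
lemma fderiv_uncurry_mollifier (hφ : IsMollifier φ) {ρ : ℝ} (hρ : 0 < ρ) (y : Space d)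
    (v : ℝ × Space d) :
    fderiv ℝ ↿(mollifier φ) (ρ, y) v =
      fderiv ℝ (mollifier φ ρ) y (v.2 - (v.1 / ρ) • y) - v.1 * (d / ρ) * mollifier φ ρ y := by
  have hdiff : DifferentiableAt ℝ ↿(mollifier φ) (ρ, y) :=
    ((contDiffOn_uncurry_mollifier hφ).contDiffAt
      ((isOpen_Ioi.prod isOpen_univ).mem_nhds
        (show (ρ, y) ∈ Ioi (0 : ℝ) ×ˢ (univ : Set (Space d)) from ⟨hρ, mem_univ _⟩))).differentiableAt one_ne_zero
  have hφd : HasFDerivAt φ (fderiv ℝ φ (ρ⁻¹ • y)) (ρ⁻¹ • y) :=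
    (hφ.smooth.differentiable (by simp) _).hasFDerivAt
  have hy : HasFDerivAt (mollifier φ ρ)
      ((ρ ^ d)⁻¹ • (fderiv ℝ φ (ρ⁻¹ • y)).comp (ρ⁻¹ • ContinuousLinearMap.id ℝ (Space d))) y :=
    (hφd.comp y ((hasFDerivAt_id y).const_smul ρ⁻¹)).const_mul _
  -- The directional derivative is computed twice along this line: by the chain rule and from the
  -- explicit formula.
  have hc : HasDerivAt (fun θ : ℝ => (ρ + θ * v.1, y + θ • v.2)) v 0 := by
    have h1 : HasDerivAt (fun θ : ℝ => ρ + θ * v.1) v.1 0 := by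
      simpa using ((hasDerivAt_id (0 : ℝ)).mul_const v.1).const_add ρ
    have h2 : HasDerivAt (fun θ : ℝ => y + θ • v.2) v.2 0 := by
      simpa using ((hasDerivAt_id (0 : ℝ)).smul_const v.2).const_add y
    exact h1.prodMk h2
  have e1 : HasDerivAt (fun θ : ℝ => ↿(mollifier φ) (ρ + θ * v.1, y + θ • v.2))
      (fderiv ℝ ↿(mollifier φ) (ρ, y) v) 0 := by
    refine HasFDerivAt.comp_hasDerivAt (0 : ℝ) ?_ hc
    simpa using hdiff.hasFDerivAt
  have e2 : HasDerivAt (fun θ : ℝ => ((ρ + θ * v.1) ^ d)⁻¹ * φ ((ρ + θ * v.1)⁻¹ • (y + θ • v.2)))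
      (-(d * ρ ^ (d - 1) * v.1) / (ρ ^ d) ^ 2 * φ (ρ⁻¹ • y) +
        (ρ ^ d)⁻¹ * fderiv ℝ φ (ρ⁻¹ • y) (ρ⁻¹ • v.2 + (-v.1 / ρ ^ 2) • y)) 0 := by
    have h1 : HasDerivAt (fun θ : ℝ => ρ + θ * v.1) v.1 0 := by
      simpa using ((hasDerivAt_id (0 : ℝ)).mul_const v.1).const_add ρ
    have h2 : HasDerivAt (fun θ : ℝ => y + θ • v.2) v.2 0 := by
      simpa using ((hasDerivAt_id (0 : ℝ)).smul_const v.2).const_add y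
    have h3 := (h1.fun_pow d).fun_inv (by simpa using (pow_pos hρ d).ne')
    have h4 := (h1.fun_inv (by simpa using hρ.ne')).fun_smul h2
    have h5 : HasFDerivAt φ (fderiv ℝ φ (ρ⁻¹ • y))
      ((ρ + 0 * v.1)⁻¹ • (y + (0 : ℝ) • v.2)) := by simpa using hφd
    have h6 := h3.fun_mul (h5.comp_hasDerivAt (0 : ℝ) h4)
    simpa using h6
  have e3 := e1.unique e2
  rw [e3, hy.fderiv]
  have hρ' := hρ.ne'
  rcases d with _ | n
  · have : y = 0 := Subsingleton.elim _ _
    have h2 : v.2 = 0 := Subsingleton.elim _ _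
    simp [this, h2]
  · simp only [smul_apply, ContinuousLinearMap.comp_apply, map_add, map_smul,
      map_sub, smul_eq_mul, mollifier, ContinuousLinearMap.id_apply]
    push_cast
    field_simp
    ring

/-- Integrating a weak gradient against an affine vector field times a mollifier. -/
lemma IsWeakGradient.integral_mollifier {w : Space d → Space d}
    {A : Space d → Space d →L[ℝ] Space d} (hw : IsWeakGradient w A) (hφ : IsMollifier φ)
    {ρ : ℝ} (hρ : 0 < ρ) (x : Space d) (v : ℝ × Space d) :
    ∫ z, fderiv ℝ ↿(mollifier φ) (ρ, x - z) v • w z =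
      ∫ z, mollifier φ ρ (x - z) • A z (v.2 - (v.1 / ρ) • (x - z)) := by
  set b := EuclideanSpace.basisFun (Fin d) ℝ with hb
  set V : Space d → Space d := fun z => v.2 - (v.1 / ρ) • (x - z) with hV
  set ψ : Fin d → Space d → ℝ := fun i z => mollifier φ ρ (x - z) * V z i with hψ
  have hVs : ContDiff ℝ (⊤ : ℕ∞) V := by
    simp only [hV]; fun_prop
  have hψs : ∀ i, ContDiff ℝ (⊤ : ℕ∞) (ψ i) := fun i =>
    ((contDiff_mollifier hφ ρ).comp (contDiff_const.sub contDiff_id)).mul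
      ((EuclideanSpace.proj (𝕜 := ℝ) i).contDiff.comp hVs)
  have hψ0 : ∀ i z, z ∉ closedBall x ρ → ψ i z = 0 := by
    intro i z hz
    rw [mem_closedBall, not_le, dist_comm, dist_eq_norm] at hz
    simp [hψ, mollifier_eq_zero hφ hρ hz.le]
  have hψc : ∀ i, HasCompactSupport (ψ i) := fun i =>
    HasCompactSupport.intro (isCompact_closedBall x ρ) (hψ0 i)
  -- Since `div V = d v.1 / ρ`, the kernel derivative is minus the divergence in `z` of `φ_ρ(x - z)
  -- V(z)`, which is the form that the weak gradient can be tested against.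
  have key : ∀ z, fderiv ℝ ↿(mollifier φ) (ρ, x - z) v = - ∑ i, fderiv ℝ (ψ i) z (b i) := by
    intro z
    have hm : HasFDerivAt (fun z => mollifier φ ρ (x - z))
        (-fderiv ℝ (mollifier φ ρ) (x - z)) z := by
      have h1 := ((contDiff_mollifier hφ ρ).differentiable (by simp) (x - z)).hasFDerivAt
      have h2 : HasFDerivAt (fun z => x - z) (-ContinuousLinearMap.id ℝ (Space d)) z :=
        (hasFDerivAt_id (𝕜 := ℝ) z).const_sub x
      convert! h1.comp z h2 using 1
      ext
      simp
    have hVd : ∀ i, HasFDerivAt (fun z => V z i)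
        ((v.1 / ρ) • (EuclideanSpace.proj (𝕜 := ℝ) i : Space d →L[ℝ] ℝ)) z := by
      intro i
      have h2 : HasFDerivAt V ((v.1 / ρ) • ContinuousLinearMap.id ℝ (Space d)) z := by
        have := (((hasFDerivAt_id (𝕜 := ℝ) z).const_sub x).const_smul (v.1 / ρ)).const_sub v.2
        convert! this using 1
        ext; simp
      convert! (EuclideanSpace.proj (𝕜 := ℝ) i).hasFDerivAt.comp z h2 using 1
    have hsum : ∀ i, fderiv ℝ (ψ i) z (b i) =
        mollifier φ ρ (x - z) * (v.1 / ρ) -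
          V z i * fderiv ℝ (mollifier φ ρ) (x - z) (b i) := by
      intro i
      rw [(hm.fun_mul (hVd i)).fderiv]
      simp [hb, EuclideanSpace.basisFun_apply]
      ring
    have hVz : fderiv ℝ (mollifier φ ρ) (x - z) (V z) =
        ∑ i, V z i * fderiv ℝ (mollifier φ ρ) (x - z) (b i) := by
      conv_lhs => rw [← b.sum_repr (V z)]
      simp [map_sum, hb]
    rw [fderiv_uncurry_mollifier hφ hρ, show v.2 - (v.1 / ρ) • (x - z) = V z from rfl, Finset.sum_congr rfl fun i _ => hsum i,
      Finset.sum_sub_distrib, ← hVz]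
    simp
    ring
  have hint1 : ∀ i, Integrable (fun z => fderiv ℝ (ψ i) z (b i) • w z) := by
    intro i
    refine hw.locallyIntegrable.integrable_smul_left_of_hasCompactSupport ?_ ?_
    · exact ((hψs i).continuous_fderiv (by simp)).clm_apply continuous_const
    · exact (hψc i).fderiv_apply (𝕜 := ℝ) (b i)
  have hint2 : ∀ i, Integrable (fun z => ψ i z • A z (b i)) := by
    intro i
    have h := hw.locallyIntegrable_grad.integrable_smul_left_of_hasCompactSupport
      (hψs i).continuous (hψc i)
    simpa using h.apply_continuousLinearMap (b i)
  calc ∫ z, fderiv ℝ ↿(mollifier φ) (ρ, x - z) v • w z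
      = ∫ z, - ∑ i, fderiv ℝ (ψ i) z (b i) • w z := by
        congr with z : 1
        rw [key, neg_smul, Finset.sum_smul]
    _ = ∑ i, ∫ z, ψ i z • A z (b i) := by
        rw [integral_neg, integral_finsetSum _ fun i _ => hint1 i, ← Finset.sum_neg_distrib]
        refine Finset.sum_congr rfl fun i _ => ?_
        rw [hw.integral_eq _ (hψs i) (hψc i), neg_neg]
    _ = _ := by
        rw [← integral_finsetSum _ fun i _ => hint2 i]
        congr with z : 1
        conv_rhs => rw [show v.2 - (v.1 / ρ) • (x - z) = V z from rfl, ← b.sum_repr (V z)]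
        simp [map_sum, hψ, hb, mul_smul, Finset.smul_sum]

lemma IsWeakGradient.exists_hasFDerivAt {w : Space d → Space d}
    {A : Space d → Space d →L[ℝ] Space d} (hw : IsWeakGradient w A) (hφ : IsMollifier φ)
    {ρ : ℝ} (hρ : 0 < ρ) (x : Space d) :
    ∃ D : ℝ × Space d →L[ℝ] Space d,
      HasFDerivAt (fun q : ℝ × Space d =>
        (mollifier φ q.1 ⋆[ContinuousLinearMap.lsmul ℝ ℝ, volume] w) q.2) D (ρ, x) ∧
      ∀ v : ℝ × Space d,
        D v = ∫ z, mollifier φ ρ (x - z) • A z (v.2 - (v.1 / ρ) • (x - z)) := by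
  -- Differentiation under the integral needs one compact set containing the supports for all nearby
  -- scales, hence the radius `ρ + 1`.
  have h := hasFDerivAt_convolution_right_with_param (𝕜 := ℝ) (μ := volume)
    (ContinuousLinearMap.lsmul ℝ ℝ (E := Space d)).flip (g := mollifier φ)
    (s := Ioo 0 (ρ + 1)) (k := closedBall (0 : Space d) (ρ + 1)) isOpen_Ioo
    (isCompact_closedBall _ _) (fun p y hp hy => mollifier_eq_zero hφ hp.1 (by
      rw [mem_closedBall_zero_iff, not_le] at hy
      exact (hp.2.trans hy).le)) hw.locallyIntegrable
    ((contDiffOn_uncurry_mollifier hφ).mono (prod_mono_left Ioo_subset_Ioi_self))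
    (ρ, x) ⟨hρ, by simp⟩
  simp only [convolution_flip] at h
  refine ⟨_, h, fun v => ?_⟩
  rw [← hw.integral_mollifier hφ hρ x v]
  have hcont : Continuous fun y => fderiv ℝ ↿(mollifier φ) (ρ, y) := by
    have h1 := (contDiffOn_uncurry_mollifier hφ).continuousOn_fderiv_of_isOpen
      (isOpen_Ioi.prod isOpen_univ) le_rfl
    exact h1.comp_continuous (by fun_prop) fun y => ⟨hρ, mem_univ _⟩
  have hsupp : HasCompactSupport fun y => fderiv ℝ ↿(mollifier φ) (ρ, y) := by
    refine HasCompactSupport.intro (isCompact_closedBall (0 : Space d) ρ) fun y hy => ?_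
    rw [mem_closedBall_zero_iff, not_le] at hy
    have h0 : mollifier φ ρ =ᶠ[𝓝 y] fun _ => 0 := by
      filter_upwards [(isOpen_lt continuous_const continuous_norm).mem_nhds hy] with z hz
      exact mollifier_eq_zero hφ hρ (le_of_lt hz)
    refine ContinuousLinearMap.ext fun v => ?_
    rw [fderiv_uncurry_mollifier hφ hρ, h0.fderiv_eq, h0.self_of_nhds]
    simp
  have h2 := convolution_precompR_apply (𝕜 := ℝ) (μ := volume)
    (ContinuousLinearMap.lsmul ℝ ℝ (E := Space d)).flip hw.locallyIntegrable hsupp hcont x v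
  refine h2.trans ?_
  simp [convolution_def]

end Mollifier

/-! ### Velocity increments and the maximal function of the gradient -/

section VelocityEstimate

variable {d : ℕ} {φ : Space d → ℝ} {w : Space d → Space d} {A : Space d → Space d →L[ℝ] Space d}

/-- The scaled integral `ρ^{-d} ∫_{B_ρ(x)} |A|`. -/
noncomputable def scaledAverage (A : Space d → Space d →L[ℝ] Space d) (ρ : ℝ) (x : Space d) :
    ℝ≥0∞ :=
  ENNReal.ofReal (ρ ^ d)⁻¹ * ∫⁻ z in ball x ρ, ‖A z‖ₑ

/-- On the support of the kernel `|x - z| < ρ`, which absorbs the factor `1 / ρ` of the scale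
derivative. -/
lemma enorm_integral_mollifier_le (hφ : IsMollifier φ) {K : ℝ≥0} (hK : ∀ x, ‖φ x‖ ≤ K) {ρ : ℝ}
    (hρ : 0 < ρ) (x : Space d) (v : ℝ × Space d) :
    ‖∫ z, mollifier φ ρ (x - z) • A z (v.2 - (v.1 / ρ) • (x - z))‖ₑ ≤
      ENNReal.ofReal (|v.1| + ‖v.2‖) * (K * scaledAverage A ρ x) := by
  calc ‖∫ z, mollifier φ ρ (x - z) • A z (v.2 - (v.1 / ρ) • (x - z))‖ₑ
      ≤ ∫⁻ z, ‖mollifier φ ρ (x - z) • A z (v.2 - (v.1 / ρ) • (x - z))‖ₑ :=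
        enorm_integral_le_lintegral_enorm _
    _ ≤ ∫⁻ z, (ball x ρ).indicator (fun z => ENNReal.ofReal (|v.1| + ‖v.2‖) *
          (K * ENNReal.ofReal (ρ ^ d)⁻¹) * ‖A z‖ₑ) z := by
        refine lintegral_mono fun z => ?_
        by_cases hz : z ∈ ball x ρ
        · rw [indicator_of_mem hz, enorm_smul]
          rw [mem_ball, dist_comm, dist_eq_norm] at hz
          have h1 : ‖mollifier φ ρ (x - z)‖ₑ ≤ K * ENNReal.ofReal (ρ ^ d)⁻¹ := by
            rw [← ofReal_norm, mul_comm, ← ENNReal.ofReal_coe_nnreal (p := K),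
              ← ENNReal.ofReal_mul (by positivity)]
            exact ENNReal.ofReal_le_ofReal (norm_mollifier_le hK hρ _)
          have h2 : ‖v.2 - (v.1 / ρ) • (x - z)‖ₑ ≤ ENNReal.ofReal (|v.1| + ‖v.2‖) := by
            rw [← ofReal_norm]
            refine ENNReal.ofReal_le_ofReal ((norm_sub_le _ _).trans ?_)
            rw [norm_smul, norm_div, Real.norm_of_nonneg hρ.le, Real.norm_eq_abs, add_comm]
            gcongr
            rw [div_mul_eq_mul_div, div_le_iff₀ hρ]
            gcongr
          calc _ ≤ (K * ENNReal.ofReal (ρ ^ d)⁻¹) *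
                (‖A z‖ₑ * ENNReal.ofReal (|v.1| + ‖v.2‖)) := by
                gcongr
                exact ((A z).le_opENorm _).trans (by gcongr)
            _ = _ := by ring
        · rw [mem_ball, not_lt, dist_comm, dist_eq_norm] at hz
          simp [mollifier_eq_zero hφ hρ hz]
    _ = _ := by
        rw [lintegral_indicator measurableSet_ball, lintegral_const_mul' _ _ (by finiteness),
          scaledAverage]
        ring

lemma volume_ball_eq (x : Space d) {r : ℝ} (hr : 0 < r) :
    volume (ball x r) = ENNReal.ofReal (r ^ d) * volume (ball (0 : Space d) 1) := by
  rw [Measure.addHaar_ball_of_pos _ _ hr, finrank_euclideanSpace_fin]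

lemma laverage_ball_le_spatialMaximal {F : Type*} [NormedAddCommGroup F] (g : Space d → F)
    (x : Space d) {r : ℝ} (hr : 0 < r) :
    (volume (ball x r))⁻¹ * ∫⁻ y in ball x r, ‖g y‖ₑ ≤ spatialMaximal g x := by
  refine le_trans (le_of_eq ?_) (le_iSup₂_of_le r hr le_rfl)
  rw [setLAverage_eq, ENNReal.div_eq_inv_mul]

/-- The scaled average is controlled by the maximal function at nearby points. -/
lemma scaledAverage_le_spatialMaximal (A : Space d → Space d →L[ℝ] Space d) {ρ : ℝ} (hρ : 0 < ρ)
    {x y : Space d} (hxy : ‖y - x‖ ≤ 6 * ρ) :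
    scaledAverage A ρ x ≤ (7 ^ d * volume (ball (0 : Space d) 1)) * spatialMaximal A y := by
  have hsub : ball x ρ ⊆ ball y (7 * ρ) := by
    refine ball_subset_ball' ?_
    rw [dist_comm, dist_eq_norm]
    linarith
  have h1 := laverage_ball_le_spatialMaximal A y (show 0 < 7 * ρ by positivity)
  rw [volume_ball_eq y (show 0 < 7 * ρ by positivity)] at h1
  have hV : volume (ball (0 : Space d) 1) ≠ 0 := (measure_ball_pos _ _ one_pos).ne'
  have hV' : volume (ball (0 : Space d) 1) ≠ ∞ := measure_ball_lt_top.ne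
  have hc : ENNReal.ofReal (ρ ^ d)⁻¹ = (7 ^ d * volume (ball (0 : Space d) 1)) *
      (ENNReal.ofReal ((7 * ρ) ^ d) * volume (ball (0 : Space d) 1))⁻¹ := by
    rw [ENNReal.mul_inv (by left; positivity) (by right; exact hV), mul_pow,
      ENNReal.ofReal_mul (by positivity), ENNReal.mul_inv (by left; positivity) (by left; finiteness),
      ENNReal.ofReal_inv_of_pos (by positivity),
      show ENNReal.ofReal (7 ^ d) = 7 ^ d by rw [ENNReal.ofReal_pow (by positivity)]; simp]
    have h7 : (7 : ℝ≥0∞) ^ d * ((7 : ℝ≥0∞) ^ d)⁻¹ = 1 :=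
      ENNReal.mul_inv_cancel (by positivity) (by finiteness)
    have hv : volume (ball (0 : Space d) 1) * (volume (ball (0 : Space d) 1))⁻¹ = 1 :=
      ENNReal.mul_inv_cancel hV hV'
    calc (ENNReal.ofReal (ρ ^ d))⁻¹
        = ((7 : ℝ≥0∞) ^ d * ((7 : ℝ≥0∞) ^ d)⁻¹) *
          (volume (ball (0 : Space d) 1) * (volume (ball (0 : Space d) 1))⁻¹) *
            (ENNReal.ofReal (ρ ^ d))⁻¹ := by rw [h7, hv, one_mul, one_mul]
      _ = _ := by ring
  calc scaledAverage A ρ x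
      ≤ ENNReal.ofReal (ρ ^ d)⁻¹ * ∫⁻ z in ball y (7 * ρ), ‖A z‖ₑ := by
        unfold scaledAverage
        gcongr
    _ = (7 ^ d * volume (ball (0 : Space d) 1)) *
        ((ENNReal.ofReal ((7 * ρ) ^ d) * volume (ball (0 : Space d) 1))⁻¹ *
          ∫⁻ z in ball y (7 * ρ), ‖A z‖ₑ) := by rw [hc, mul_assoc]
    _ ≤ _ := by gcongr

/-- The mean value inequality in `ℝ≥0∞`, so that points where the maximal function is infinite need
no separate treatment. -/
lemma enorm_sub_le_of_enorm_hasFDerivAt_le {E F : Type*} [NormedAddCommGroup E] [NormedSpace ℝ E]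
    [NormedAddCommGroup F] [NormedSpace ℝ F] {f : E → F} {f' : E → E →L[ℝ] F} {a b : E}
    {B : ℝ≥0∞} (hf : ∀ p ∈ segment ℝ a b, HasFDerivAt f (f' p) p)
    (hB : ∀ p ∈ segment ℝ a b, ∀ v, ‖f' p v‖ₑ ≤ ENNReal.ofReal ‖v‖ * B) :
    ‖f b - f a‖ₑ ≤ ENNReal.ofReal ‖b - a‖ * B := by
  rcases eq_or_ne b a with rfl | hne
  · simp
  rcases eq_or_ne B ∞ with rfl | hBt
  · rw [ENNReal.mul_top]
    · exact le_top
    · simpa [sub_eq_zero] using hne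
  lift B to ℝ≥0 using hBt
  have h := (convex_segment a b).norm_image_sub_le_of_norm_hasFDerivWithin_le (C := B)
    (fun p hp => (hf p hp).hasFDerivWithinAt) (fun p hp => ?_) (left_mem_segment ℝ a b)
    (right_mem_segment ℝ a b)
  · rw [← ofReal_norm, ← ENNReal.ofReal_coe_nnreal (p := B),
      ← ENNReal.ofReal_mul (norm_nonneg _), mul_comm]
    exact ENNReal.ofReal_le_ofReal h
  · refine ContinuousLinearMap.opNorm_le_bound _ B.2 fun v => ?_
    have h1 := hB p hp v
    rw [← ofReal_norm, ← ENNReal.ofReal_coe_nnreal (p := B),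
      ← ENNReal.ofReal_mul (norm_nonneg _), mul_comm] at h1
    exact (ENNReal.ofReal_le_ofReal_iff (by positivity)).1 h1

/-- Spatial and scale increments of mollifications. -/
lemma IsWeakGradient.enorm_mollification_sub_le (hw : IsWeakGradient w A) (hφ : IsMollifier φ)
    {K : ℝ≥0} (hK : ∀ x, ‖φ x‖ ≤ K) {ρ ρ' : ℝ} (hρ : 0 < ρ) (hρ' : 0 < ρ') (x x' : Space d)
    {B B' : ℝ≥0∞} (hB : ∀ r ∈ uIcc ρ ρ', K * scaledAverage A r x ≤ B)
    (hB' : ∀ p ∈ segment ℝ x x', K * scaledAverage A ρ' p ≤ B') :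
    ‖(mollifier φ ρ ⋆[ContinuousLinearMap.lsmul ℝ ℝ, volume] w) x -
      (mollifier φ ρ' ⋆[ContinuousLinearMap.lsmul ℝ ℝ, volume] w) x'‖ₑ ≤
      ENNReal.ofReal |ρ - ρ'| * B + ENNReal.ofReal ‖x - x'‖ * B' := by
  set Φ := fun q : ℝ × Space d =>
    (mollifier φ q.1 ⋆[ContinuousLinearMap.lsmul ℝ ℝ, volume] w) q.2 with hΦ
  choose! D hD hDv using fun (q : ℝ × Space d) (hq : 0 < q.1) =>
    hw.exists_hasFDerivAt hφ hq q.2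
  have hpos : ∀ r ∈ uIcc ρ ρ', 0 < r := fun r hr => (lt_min hρ hρ').trans_le hr.1
  -- The path changes the scale first, at the fixed point `x`, and then moves in space at the final
  -- scale `ρ'`. Hence the asymmetric hypotheses.
  have h1 : ‖Φ (ρ', x) - Φ (ρ, x)‖ₑ ≤ ENNReal.ofReal ‖ρ' - ρ‖ * B := by
    refine enorm_sub_le_of_enorm_hasFDerivAt_le (f := fun r => Φ (r, x))
      (f' := fun r => (D (r, x)).comp (ContinuousLinearMap.inl ℝ ℝ (Space d))) ?_ ?_
    · intro r hr
      rw [segment_eq_uIcc] at hr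
      exact HasFDerivAt.comp (g := Φ) (f := fun e => (e, x)) r (hD (r, x) (hpos r hr))
        (hasFDerivAt_prodMk_left r x)
    · intro r hr v
      rw [segment_eq_uIcc] at hr
      rw [ContinuousLinearMap.comp_apply, hDv (r, x) (hpos r hr)]
      refine (enorm_integral_mollifier_le hφ hK (hpos r hr) x _).trans ?_
      simp only [ContinuousLinearMap.inl_apply, norm_zero, add_zero, Real.norm_eq_abs]
      gcongr
      exact hB r hr
  have h2 : ‖Φ (ρ', x') - Φ (ρ', x)‖ₑ ≤ ENNReal.ofReal ‖x' - x‖ * B' := by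
    refine enorm_sub_le_of_enorm_hasFDerivAt_le (f := fun p => Φ (ρ', p))
      (f' := fun p => (D (ρ', p)).comp (ContinuousLinearMap.inr ℝ ℝ (Space d))) ?_ ?_
    · intro p hp
      exact HasFDerivAt.comp (g := Φ) (f := fun e => (ρ', e)) p (hD (ρ', p) hρ')
        (hasFDerivAt_prodMk_right ρ' p)
    · intro p hp v
      rw [ContinuousLinearMap.comp_apply, hDv (ρ', p) hρ']
      refine (enorm_integral_mollifier_le hφ hK hρ' p _).trans ?_
      simp only [ContinuousLinearMap.inr_apply, abs_zero, zero_add]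
      gcongr
      exact hB' p hp
  calc ‖Φ (ρ, x) - Φ (ρ', x')‖ₑ = ‖(Φ (ρ', x) - Φ (ρ, x)) + (Φ (ρ', x') - Φ (ρ', x))‖ₑ := by
        rw [← enorm_neg]; congr 1; abel
    _ ≤ _ := (enorm_add_le _ _).trans (add_le_add h1 h2)
    _ = _ := by rw [Real.norm_eq_abs, abs_sub_comm, norm_sub_rev x' x]

/-- Increments of mollifications are controlled by the maximal function of the gradient. -/
lemma IsMollifier.exists_mollification_sub_le (hφ : IsMollifier φ) :
    ∃ C : ℝ≥0, ∀ (w : Space d → Space d) (A : Space d → Space d →L[ℝ] Space d),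
      IsWeakGradient w A → ∀ (ρ ρ' : ℝ) (x x' y y' : Space d), 0 < ρ → 0 < ρ' →
      (∀ r ∈ uIcc ρ ρ', ‖y - x‖ ≤ 6 * r) → (∀ p ∈ segment ℝ x x', ‖y' - p‖ ≤ 6 * ρ') →
      ‖(mollifier φ ρ ⋆[ContinuousLinearMap.lsmul ℝ ℝ, volume] w) x -
        (mollifier φ ρ' ⋆[ContinuousLinearMap.lsmul ℝ ℝ, volume] w) x'‖ₑ ≤
        C * (ENNReal.ofReal |ρ - ρ'| * spatialMaximal A y +
          ENNReal.ofReal ‖x - x'‖ * spatialMaximal A y') := by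
  obtain ⟨K, hK⟩ := hφ.exists_bound
  have hfin : (K : ℝ≥0∞) * (7 ^ d * volume (ball (0 : Space d) 1)) ≠ ∞ := by finiteness
  refine ⟨(K * (7 ^ d * volume (ball (0 : Space d) 1)) : ℝ≥0∞).toNNReal,
    fun w A hw ρ ρ' x x' y y' hρ hρ' hy hy' => ?_⟩
  rw [ENNReal.coe_toNNReal hfin]
  refine (hw.enorm_mollification_sub_le hφ hK hρ hρ' x x'
    (B := K * (7 ^ d * volume (ball (0 : Space d) 1)) * spatialMaximal A y)
    (B' := K * (7 ^ d * volume (ball (0 : Space d) 1)) * spatialMaximal A y') ?_ ?_).trans ?_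
  · intro r hr
    rw [mul_assoc]
    gcongr
    exact scaledAverage_le_spatialMaximal A ((lt_min hρ hρ').trans_le hr.1) (hy r hr)
  · intro p hp
    rw [mul_assoc]
    gcongr
    exact scaledAverage_le_spatialMaximal A hρ' (hy' p hp)
  · exact le_of_eq (by ring)

end VelocityEstimate

/-! ### The time interval, slices and measurability -/

section Measurability

variable {d : ℕ} {S T : EReal}

lemma isOpen_timeInterval (S T : EReal) : IsOpen (timeInterval S T) :=
  (isOpen_lt continuous_const continuous_coe_real_ereal).inter
    (isOpen_lt continuous_coe_real_ereal continuous_const)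

lemma ordConnected_timeInterval (S T : EReal) : (timeInterval S T).OrdConnected := by
  refine ⟨fun a ha b hb c hc => ⟨ha.1.trans_le ?_, lt_of_le_of_lt ?_ hb.2⟩⟩
  · exact_mod_cast hc.1
  · exact_mod_cast hc.2

lemma measurableSet_timeInterval (S T : EReal) : MeasurableSet (timeInterval S T) :=
  (isOpen_timeInterval S T).measurableSet

lemma uIcc_subset_timeInterval {a b : ℝ} (ha : a ∈ timeInterval S T) (hb : b ∈ timeInterval S T) :
    uIcc a b ⊆ timeInterval S T :=
  (ordConnected_timeInterval S T).uIcc_subset ha hb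

lemma isOpen_slab (d : ℕ) (S T : EReal) : IsOpen (slab d S T) :=
  (isOpen_timeInterval S T).prod isOpen_univ

lemma volume_restrict_slab (d : ℕ) (S T : EReal) :
    (volume : Measure (ℝ × Space d)).restrict (slab d S T) =
      (volume.restrict (timeInterval S T)).prod volume := by
  rw [slab, Measure.volume_eq_prod, ← Measure.prod_restrict, Measure.restrict_univ]

/-- Mollification and the maximal function see only the almost everywhere class of a slice, so a
jointly measurable version with almost all slices correct is enough. -/
lemma exists_stronglyMeasurable_slice {F : Type*} [NormedAddCommGroup F] {g : ℝ → Space d → F}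
    (hg : AEStronglyMeasurable (fun z : ℝ × Space d => g z.1 z.2)
      (volume.restrict (slab d S T))) :
    ∃ g' : ℝ × Space d → F, StronglyMeasurable g' ∧
      ∀ᵐ t ∂(volume.restrict (timeInterval S T)), g t =ᵐ[volume] fun x => g' (t, x) := by
  obtain ⟨g', hg', h⟩ := hg
  refine ⟨g', hg', ?_⟩
  rw [volume_restrict_slab] at h
  exact Measure.ae_ae_of_ae_prod h

lemma mollifiedVelocity_congr {φ : Space d → ℝ} {u u' : ℝ → Space d → Space d} {t : ℝ}
    (h : u t =ᵐ[volume] u' t) (ε : ℝ) (x : Space d) :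
    mollifiedVelocity φ u ε t x = mollifiedVelocity φ u' ε t x := by
  rw [mollifiedVelocity, convolution_congr _ (ae_eq_refl _) h, mollifiedVelocity]

lemma spatialMaximal_congr {F : Type*} [NormedAddCommGroup F] {g g' : Space d → F}
    (h : g =ᵐ[volume] g') : spatialMaximal g = spatialMaximal g' := by
  ext x
  refine iSup_congr fun r => iSup_congr fun hr => laverage_congr ?_
  filter_upwards [ae_restrict_of_ae h] with y hy
  rw [hy]

lemma aestronglyMeasurable_mollifiedVelocity_comp {φ : Space d → ℝ} (hφ : IsMollifier φ)
    {u : ℝ → Space d → Space d}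
    (hu : AEStronglyMeasurable (fun z : ℝ × Space d => u z.1 z.2) (volume.restrict (slab d S T)))
    (ε : ℝ) {γ : ℝ → Space d} (hγ : ContinuousOn γ (timeInterval S T)) :
    AEStronglyMeasurable (fun τ => mollifiedVelocity φ u ε τ (γ τ))
      (volume.restrict (timeInterval S T)) := by
  obtain ⟨u', hu', hae⟩ := exists_stronglyMeasurable_slice hu
  have hγm : AEMeasurable γ (volume.restrict (timeInterval S T)) :=
    hγ.aemeasurable (measurableSet_timeInterval S T)
  have hsm : StronglyMeasurable fun z : ℝ × Space d =>
      mollifier φ ε z.2 • u' (z.1, hγm.mk γ z.1 - z.2) := by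
    refine ((contDiff_mollifier hφ ε).continuous.comp continuous_snd).stronglyMeasurable.smul
      (hu'.comp_measurable ?_)
    exact measurable_fst.prodMk ((hγm.measurable_mk.comp measurable_fst).sub measurable_snd)
  refine ⟨_, hsm.integral_prod_right' (ν := volume), ?_⟩
  filter_upwards [hae, hγm.ae_eq_mk] with t ht hγt
  rw [mollifiedVelocity_congr (u' := fun t x => u' (t, x)) ht, hγt, mollifiedVelocity,
    convolution_def]
  rfl

/-- The maximal function only needs rational radii. -/
lemma spatialMaximal_eq_iSup_rat {F : Type*} [NormedAddCommGroup F] (g : Space d → F)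
    (x : Space d) : spatialMaximal g x =
      ⨆ (q : ℚ) (_ : 0 < (q : ℝ)), (volume (ball x (q : ℝ)))⁻¹ * ∫⁻ y in ball x (q : ℝ), ‖g y‖ₑ := by
  apply le_antisymm
  · refine iSup₂_le fun r hr => ?_
    rw [setLAverage_eq, ENNReal.div_eq_inv_mul]
    -- The rational balls exhaust the ball from inside, and dividing by their smaller volume only
    -- increases the averages.
    have hU : ball x r = ⋃ q : {q : ℚ // 0 < (q : ℝ) ∧ (q : ℝ) < r}, ball x (q : ℝ) := by
      ext y
      simp only [mem_ball, mem_iUnion, Subtype.exists, exists_prop]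
      constructor
      · intro hy
        obtain ⟨q, hq1, hq2⟩ := exists_rat_btwn hy
        exact ⟨q, ⟨dist_nonneg.trans_lt hq1, hq2⟩, hq1⟩
      · rintro ⟨q, hq, hy⟩
        exact hy.trans hq.2
    have hint : ∫⁻ y in ball x r, ‖g y‖ₑ =
        ⨆ q : {q : ℚ // 0 < (q : ℝ) ∧ (q : ℝ) < r}, ∫⁻ y in ball x (q : ℝ), ‖g y‖ₑ := by
      rw [hU]
      refine setLIntegral_iUnion_of_directed _ (Monotone.directed_le fun p q hpq => ?_)
      exact ball_subset_ball (by exact_mod_cast hpq)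
    rw [hint, ENNReal.mul_iSup]
    refine iSup_le fun q => le_iSup₂_of_le (q : ℚ) q.2.1 ?_
    gcongr
    exact q.2.2.le
  · exact iSup₂_le fun q hq => laverage_ball_le_spatialMaximal g x hq

lemma measurable_spatialMaximal {F : Type*} [NormedAddCommGroup F] {g : ℝ × Space d → F}
    (hg : StronglyMeasurable g) :
    Measurable fun z : ℝ × Space d => spatialMaximal (fun y => g (z.1, y)) z.2 := by
  simp_rw [spatialMaximal_eq_iSup_rat]
  refine Measurable.iSup fun q => Measurable.iSup fun hq => ?_
  simp_rw [Measure.addHaar_ball_center]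
  refine Measurable.const_mul ?_ _
  have h : ∀ z : ℝ × Space d, ∫⁻ y in ball z.2 (q : ℝ), ‖g (z.1, y)‖ₑ =
      ∫⁻ y, {p : (ℝ × Space d) × Space d | dist p.2 p.1.2 < q}.indicator
        (fun p => ‖g (p.1.1, p.2)‖ₑ) (z, y) := by
    intro z
    rw [← lintegral_indicator measurableSet_ball]
    rfl
  simp_rw [h]
  refine Measurable.lintegral_prod_right' (Measurable.indicator ?_ ?_)
  · exact (hg.comp_measurable
      ((measurable_fst.comp measurable_fst).prodMk measurable_snd)).enorm
  · exact (isOpen_lt (by fun_prop) continuous_const).measurableSet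

lemma aemeasurable_spatialMaximal {F : Type*} [NormedAddCommGroup F] {G : ℝ → Space d → F}
    (hG : AEStronglyMeasurable (fun z : ℝ × Space d => G z.1 z.2)
      (volume.restrict (slab d S T))) :
    AEMeasurable (fun z : ℝ × Space d => spatialMaximal (G z.1) z.2)
      (volume.restrict (slab d S T)) := by
  obtain ⟨G', hG', hae⟩ := exists_stronglyMeasurable_slice hG
  refine ⟨_, measurable_spatialMaximal hG', ?_⟩
  rw [volume_restrict_slab]
  filter_upwards [Measure.quasiMeasurePreserving_fst.ae hae] with z hz
  rw [spatialMaximal_congr hz]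

/-- For finite `q`, `h ≤ 1 + h ^ q` pointwise, so neither Hölder's inequality nor measurability of
`h` is needed. -/
lemma setLIntegral_lt_top_of_eLpNorm_lt_top {α : Type*} [MeasurableSpace α] {μ : Measure α}
    {h : α → ℝ≥0∞} {q : ℝ≥0∞} (hq : 1 ≤ q) (hh : eLpNorm h q μ < ∞) {E : Set α}
    (hE : μ E < ∞) : ∫⁻ z in E, h z ∂μ < ∞ := by
  rcases eq_or_ne q ∞ with rfl | hqt
  · rw [eLpNorm_exponent_top] at hh
    calc ∫⁻ z in E, h z ∂μ ≤ ∫⁻ _ in E, eLpNormEssSup h μ ∂μ := by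
          refine lintegral_mono_ae (ae_restrict_of_ae ?_)
          exact ae_le_eLpNormEssSup
      _ = eLpNormEssSup h μ * μ E := by rw [setLIntegral_const]
      _ < ∞ := ENNReal.mul_lt_top hh hE
  · have hq0 : q ≠ 0 := (zero_lt_one.trans_le hq).ne'
    have h1 := lintegral_rpow_enorm_lt_top_of_eLpNorm_lt_top hq0 hqt hh
    have hq1 : 1 ≤ q.toReal := by
      rw [← ENNReal.toReal_one]
      exact (ENNReal.toReal_le_toReal ENNReal.one_ne_top hqt).2 hq
    calc ∫⁻ z in E, h z ∂μ ≤ ∫⁻ z in E, 1 + ‖h z‖ₑ ^ q.toReal ∂μ := by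
          refine lintegral_mono fun z => ?_
          rcases le_total (h z) 1 with hz | hz
          · exact hz.trans le_self_add
          · refine le_trans ?_ le_add_self
            rw [enorm_eq_self]
            exact ENNReal.le_rpow_self_of_one_le hz hq1
      _ = μ E + ∫⁻ z in E, ‖h z‖ₑ ^ q.toReal ∂μ := by
          rw [lintegral_add_left measurable_const]
          simp
      _ < ∞ := ENNReal.add_lt_top.2 ⟨hE, (setLIntegral_le_lintegral _ _).trans_lt h1⟩

end Measurability

/-! ### Local integrability and Lipschitz bounds for the mollified velocity -/

section LocalBounds

variable {d : ℕ} {S T : EReal} {p : ℝ≥0∞} {φ : Space d → ℝ} {u : ℝ → Space d → Space d}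
  {G : ℝ → Space d → Space d →L[ℝ] Space d}

lemma MemL1LocHomSobolev.aestronglyMeasurable (hu : MemL1LocHomSobolev S T p u G) :
    AEStronglyMeasurable (fun z : ℝ × Space d => u z.1 z.2) (volume.restrict (slab d S T)) :=
  hu.locallyIntegrable.aestronglyMeasurable

lemma MemL1LocHomSobolev.intervalIntegrable_mollifiedVelocity (hu : MemL1LocHomSobolev S T p u G)
    (hφ : IsMollifier φ) {ε : ℝ} (hε : 0 < ε) (x : Space d) {a b : ℝ}
    (ha : a ∈ timeInterval S T) (hb : b ∈ timeInterval S T) :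
    IntervalIntegrable (fun τ => mollifiedVelocity φ u ε τ x) volume a b := by
  obtain ⟨K, hK⟩ := hφ.exists_bound
  have hsub := uIcc_subset_timeInterval ha hb
  rw [intervalIntegrable_iff]
  have hsub' : uIoc a b ⊆ timeInterval S T := uIoc_subset_uIcc.trans hsub
  refine ⟨(aestronglyMeasurable_mollifiedVelocity_comp hφ hu.aestronglyMeasurable ε
    continuousOn_const).mono_measure (Measure.restrict_mono hsub' le_rfl), ?_⟩
  have hcomp : IsCompact (uIcc a b ×ˢ closedBall x ε) :=
    isCompact_uIcc.prod (isCompact_closedBall x ε)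
  have hint := hu.locallyIntegrable.integrableOn_compact_subset
    (prod_mono hsub (subset_univ _)) hcomp
  have hmeas := hint.aestronglyMeasurable.enorm
  have hfin := hint.hasFiniteIntegral
  rw [hasFiniteIntegral_iff_enorm, Measure.volume_eq_prod, ← Measure.prod_restrict,
    lintegral_prod _ (by rwa [Measure.prod_restrict])] at hfin
  have hfin' : ∫⁻ τ in uIoc a b, ENNReal.ofReal ((ε ^ d)⁻¹ * K) *
      ∫⁻ y in closedBall x ε, ‖u τ y‖ₑ < ∞ := by
    rw [lintegral_const_mul' _ _ (by finiteness)]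
    exact ENNReal.mul_lt_top (by finiteness)
      ((lintegral_mono_set uIoc_subset_uIcc).trans_lt hfin)
  rw [hasFiniteIntegral_iff_enorm]
  refine lt_of_le_of_lt (lintegral_mono fun τ => ?_) hfin'
  rw [mollifiedVelocity, convolution_eq_swap]
  calc _ ≤ ∫⁻ y, ‖mollifier φ ε (x - y) • u τ y‖ₑ := enorm_integral_le_lintegral_enorm _
    _ ≤ ∫⁻ y, (closedBall x ε).indicator
          (fun y => ENNReal.ofReal ((ε ^ d)⁻¹ * K) * ‖u τ y‖ₑ) y := by
        refine lintegral_mono fun y => ?_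
        by_cases hy : y ∈ closedBall x ε
        · rw [indicator_of_mem hy, enorm_smul, ← ofReal_norm (mollifier φ ε (x - y))]
          gcongr
          exact norm_mollifier_le hK hε _
        · rw [mem_closedBall, not_le, dist_comm, dist_eq_norm] at hy
          simp [mollifier_eq_zero hφ hε hy.le]
    _ = _ := by
        rw [lintegral_indicator measurableSet_closedBall, lintegral_const_mul' _ _ (by finiteness)]

/-- At fixed scale the Lipschitz constant is controlled by integrals of `|∇u|` over balls of one
radius, hence through Hölder by the `L^p` norm of the slice, which is locally integrable in time. -/
lemma MemL1LocHomSobolev.exists_lipschitz_bound (hu : MemL1LocHomSobolev S T p u G) (hp : 1 ≤ p)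
    (hφ : IsMollifier φ) {ε : ℝ} (hε : 0 < ε) :
    ∃ L : ℝ → ℝ≥0∞, Measurable L ∧
      (∀ a b, Icc a b ⊆ timeInterval S T → ∫⁻ τ in Icc a b, L τ < ∞) ∧
      ∀ᵐ τ ∂(volume.restrict (timeInterval S T)), ∀ x y,
        ‖mollifiedVelocity φ u ε τ x - mollifiedVelocity φ u ε τ y‖ₑ ≤ L τ * ‖x - y‖ₑ := by
  obtain ⟨K, hK⟩ := hφ.exists_bound
  obtain ⟨G', hG', hae⟩ := exists_stronglyMeasurable_slice hu.aestronglyMeasurable_grad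
  set q := TopologicalSpace.denseSeq (Space d)
  set c : ℝ≥0∞ := K * ENNReal.ofReal (ε ^ d)⁻¹ with hc
  have hcfin : c ≠ ∞ := by finiteness
  have hsup : ∀ x, ∃ n, ball x ε ⊆ ball (q n) (2 * ε) := by
    intro x
    obtain ⟨n, hn⟩ := (TopologicalSpace.denseRange_denseSeq (Space d)).exists_dist_lt x hε
    refine ⟨n, ball_subset_ball' ?_⟩
    linarith
  -- Countably many centers keep the supremum measurable; doubling the radius lets them capture
  -- every ball of radius `ε`.
  refine ⟨fun τ => ⨆ n, c * ∫⁻ y in ball (q n) (2 * ε), ‖G' (τ, y)‖ₑ, ?_, ?_, ?_⟩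
  · refine Measurable.iSup fun n => Measurable.const_mul ?_ _
    exact hG'.enorm.lintegral_prod_right'
  · intro a b hab
    set c' : ℝ≥0∞ := c * volume (ball (0 : Space d) (2 * ε)) ^ (1 / (1 : ℝ≥0∞).toReal - 1 / p.toReal)
    have hV : 0 < volume (ball (0 : Space d) (2 * ε)) := measure_ball_pos _ _ (by positivity)
    have hc' : c' ≠ ∞ := by
      refine ENNReal.mul_ne_top hcfin (ENNReal.rpow_ne_top_of_nonneg' hV measure_ball_lt_top.ne)
    have hbound : ∀ᵐ τ ∂(volume.restrict (Icc a b)),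
        (⨆ n, c * ∫⁻ y in ball (q n) (2 * ε), ‖G' (τ, y)‖ₑ) ≤ c' * eLpNorm (G τ) p volume := by
      have h1 := ae_mono (Measure.restrict_mono hab le_rfl) hae
      have h2 := ae_mono (Measure.restrict_mono hab le_rfl) hu.isWeakGradient
      filter_upwards [h1, h2] with τ hτ hτ2
      refine iSup_le fun n => ?_
      have hm : AEStronglyMeasurable (G τ) (volume.restrict (ball (q n) (2 * ε))) :=
        hτ2.locallyIntegrable_grad.aestronglyMeasurable.restrict
      have h3 := eLpNorm_le_eLpNorm_mul_rpow_measure_univ hp hm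
      rw [Measure.restrict_apply_univ, Measure.addHaar_ball_center, eLpNorm_one_eq_lintegral_enorm]
        at h3
      have h4 : ∫⁻ y in ball (q n) (2 * ε), ‖G' (τ, y)‖ₑ = ∫⁻ y in ball (q n) (2 * ε), ‖G τ y‖ₑ := by
        refine lintegral_congr_ae (ae_restrict_of_ae ?_)
        filter_upwards [hτ] with y hy
        rw [hy]
      rw [h4]
      calc _ ≤ c * (eLpNorm (G τ) p volume * volume (ball (0 : Space d) (2 * ε)) ^
            (1 / (1 : ℝ≥0∞).toReal - 1 / p.toReal)) := by
            gcongr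
            exact h3.trans (by gcongr; exact Measure.restrict_le_self)
        _ = _ := by ring
    refine (lintegral_mono_ae hbound).trans_lt ?_
    rw [lintegral_const_mul' _ _ hc']
    exact ENNReal.mul_lt_top hc'.lt_top (hu.lintegral_lt_top a b hab)
  · filter_upwards [hae, hu.isWeakGradient] with τ hτ hτ2 x y
    -- The two scales are equal, so the bound `∞` for the scale derivative is multiplied by zero.
    have h := hτ2.enorm_mollification_sub_le hφ hK hε hε x y
      (B := ∞) (B' := ⨆ n, c * ∫⁻ y in ball (q n) (2 * ε), ‖G' (τ, y)‖ₑ) (fun _ _ => le_top) ?_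
    · simpa [mollifiedVelocity, mul_comm] using h
    · intro z _
      obtain ⟨n, hn⟩ := hsup z
      refine le_iSup_of_le n ?_
      rw [scaledAverage, ← mul_assoc]
      refine mul_le_mul_right ((lintegral_mono_set hn).trans (le_of_eq ?_)) _
      refine lintegral_congr_ae (ae_restrict_of_ae ?_)
      filter_upwards [hτ] with y hy
      rw [hy]

end LocalBounds

/-! ### Carathéodory solutions by Picard iteration -/

section Caratheodory

variable {E : Type*} [NormedAddCommGroup E] [NormedSpace ℝ E]

lemma absolutelyContinuousOnInterval_pow {f : ℝ → ℝ} {a b : ℝ}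
    (hf : AbsolutelyContinuousOnInterval f a b) (n : ℕ) :
    AbsolutelyContinuousOnInterval (fun x => f x ^ (n + 1)) a b := by
  induction n with
  | zero => simpa using hf
  | succ n ih =>
    have := ih.fun_mul hf
    simpa [pow_succ] using this

/-- For merely integrable `L` the primitive is absolutely continuous, and so are its powers; the
fundamental theorem of calculus still applies. This yields the factorials in the iteration. -/
lemma integral_mul_primitive_pow {L : ℝ → ℝ} {a b : ℝ} (hL : IntervalIntegrable L volume a b)
    (n : ℕ) : ∫ τ in a..b, L τ * (∫ σ in a..τ, L σ) ^ n = (∫ σ in a..b, L σ) ^ (n + 1) / (n + 1) := by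
  have hac := absolutelyContinuousOnInterval_pow
    (hL.absolutelyContinuousOnInterval_intervalIntegral (c := a) left_mem_uIcc) n
  have h := hac.integral_deriv_eq_sub
  have hn : ((n : ℝ) + 1) ≠ 0 := by positivity
  rw [intervalIntegral.integral_same, zero_pow (Nat.succ_ne_zero n), sub_zero] at h
  rw [eq_div_iff hn, ← h, mul_comm, ← intervalIntegral.integral_const_mul]
  refine intervalIntegral.integral_congr_ae ?_
  filter_upwards [hL.ae_hasDerivAt_integral] with τ hτ hmem
  have h1 := (hτ (uIoc_subset_uIcc hmem) a left_mem_uIcc).fun_pow (n + 1)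
  rw [h1.deriv]
  push_cast
  ring

lemma abs_integral_mul_abs_primitive_pow {L : ℝ → ℝ} (hL0 : ∀ τ, 0 ≤ L τ) {a b : ℝ}
    (hL : IntervalIntegrable L volume a b) (n : ℕ) :
    |∫ τ in a..b, L τ * |∫ σ in a..τ, L σ| ^ n| = |∫ σ in a..b, L σ| ^ (n + 1) / (n + 1) := by
  have hn : (0 : ℝ) ≤ n + 1 := by positivity
  have h := congrArg abs (integral_mul_primitive_pow hL n)
  rw [abs_div, abs_of_nonneg hn, abs_pow] at h
  rw [← h]
  rcases le_total a b with hab | hab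
  · congr 1
    refine intervalIntegral.integral_congr fun τ hτ => ?_
    rw [uIcc_of_le hab] at hτ
    rw [abs_of_nonneg (intervalIntegral.integral_nonneg hτ.1 fun σ _ => hL0 σ)]
  · have h1 : ∫ τ in a..b, L τ * |∫ σ in a..τ, L σ| ^ n =
        ∫ τ in a..b, (-1) ^ n * (L τ * (∫ σ in a..τ, L σ) ^ n) := by
      refine intervalIntegral.integral_congr fun τ hτ => ?_
      rw [uIcc_of_ge hab] at hτ
      rw [intervalIntegral.integral_symm, abs_neg,
        abs_of_nonneg (intervalIntegral.integral_nonneg hτ.2 fun σ _ => hL0 σ), neg_pow]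
      have : ((-1 : ℝ) ^ n) * (-1) ^ n = 1 := by rw [← mul_pow]; simp
      linear_combination (-(L τ * (∫ u in τ..a, L u) ^ n)) * this
    rw [h1, intervalIntegral.integral_const_mul, abs_mul, abs_pow, abs_neg, abs_one, one_pow,
      one_mul]

lemma continuousOn_primitive_of_forall_intervalIntegrable {I : Set ℝ} (hI : IsOpen I)
    {f : ℝ → E} {t : ℝ} (ht : t ∈ I)
    (hf : ∀ a ∈ I, ∀ b ∈ I, IntervalIntegrable f volume a b) :
    ContinuousOn (fun s => ∫ τ in t..s, f τ) I := by
  intro s hs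
  obtain ⟨δ, hδ, hball⟩ := Metric.isOpen_iff.1 hI s hs
  have hl : s - δ / 2 ∈ I := hball (by
    rw [mem_ball, Real.dist_eq]
    rw [abs_lt]; constructor <;> linarith)
  have hr : s + δ / 2 ∈ I := hball (by
    rw [mem_ball, Real.dist_eq]
    rw [abs_lt]; constructor <;> linarith)
  have hmin : min (s - δ / 2) t ∈ I := by
    rcases min_choice (s - δ / 2) t with h | h <;> rw [h] <;> assumption
  have hmax : max (s + δ / 2) t ∈ I := by
    rcases max_choice (s + δ / 2) t with h | h <;> rw [h] <;> assumption
  have hle : min (s - δ / 2) t ≤ max (s + δ / 2) t := (min_le_right _ _).trans (le_max_right _ _)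
  have h := intervalIntegral.continuousOn_primitive_interval' (a := t) (hf _ hmin _ hmax) (by
    rw [uIcc_of_le hle]; exact ⟨min_le_right _ _, le_max_right _ _⟩)
  refine (h.continuousAt ?_).continuousWithinAt
  rw [uIcc_of_le hle]
  refine Icc_mem_nhds ((min_le_left _ _).trans_lt (by linarith))
    (lt_of_lt_of_le (by linarith) (le_max_left _ _))

variable [CompleteSpace E]

/-- Existence of Carathéodory solutions for velocities that are Lipschitz in space with a locally
integrable constant. -/
theorem exists_caratheodory_solution {I : Set ℝ} (hI : IsOpen I) (hIc : I.OrdConnected)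
    {v : ℝ → E → E} {L : ℝ → ℝ} (hL0 : ∀ τ, 0 ≤ L τ)
    (hL : ∀ a ∈ I, ∀ b ∈ I, IntervalIntegrable L volume a b)
    (hv : ∀ᵐ τ ∂(volume.restrict I), ∀ x y, ‖v τ x - v τ y‖ ≤ L τ * ‖x - y‖)
    (hv0 : ∀ x, ∀ a ∈ I, ∀ b ∈ I, IntervalIntegrable (fun τ => v τ x) volume a b)
    (hm : ∀ γ : ℝ → E, ContinuousOn γ I →
      AEStronglyMeasurable (fun τ => v τ (γ τ)) (volume.restrict I))
    {t : ℝ} (ht : t ∈ I) (x : E) :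
    ∃ γ : ℝ → E, ∀ s ∈ I, IntervalIntegrable (fun τ => v τ (γ τ)) volume t s ∧
      γ s = x + ∫ τ in t..s, v τ (γ τ) := by
  have hsub : ∀ a ∈ I, ∀ b ∈ I, uIoc a b ⊆ I := fun a ha b hb =>
    uIoc_subset_uIcc.trans (hIc.uIcc_subset ha hb)
  have hvs : ∀ a ∈ I, ∀ b ∈ I, ∀ᵐ τ ∂(volume.restrict (uIoc a b)), ∀ x y,
      ‖v τ x - v τ y‖ ≤ L τ * ‖x - y‖ := fun a ha b hb =>
    ae_mono (Measure.restrict_mono (hsub a ha b hb) le_rfl) hv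
  have hint : ∀ γ : ℝ → E, ContinuousOn γ I → ∀ a ∈ I, ∀ b ∈ I,
      IntervalIntegrable (fun τ => v τ (γ τ)) volume a b := by
    intro γ hγ a ha b hb
    obtain ⟨C, hC⟩ := isCompact_uIcc.exists_bound_of_continuousOn
      (hγ.mono (hIc.uIcc_subset ha hb))
    refine (((hL a ha b hb).mul_const C).add (hv0 0 a ha b hb).norm).mono_fun'
      ((hm γ hγ).mono_measure (Measure.restrict_mono (hsub a ha b hb) le_rfl)) ?_
    filter_upwards [hvs a ha b hb, ae_restrict_mem measurableSet_uIoc] with τ hτ hmem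
    have h1 := hτ (γ τ) 0
    have h2 := hC τ (uIoc_subset_uIcc hmem)
    have h3 : L τ * ‖γ τ - 0‖ ≤ L τ * C := by
      rw [sub_zero]; exact mul_le_mul_of_nonneg_left h2 (hL0 τ)
    have h4 := norm_sub_norm_le (v τ (γ τ)) (v τ 0)
    linarith
  set P : (ℝ → E) → ℝ → E := fun γ s => x + ∫ τ in t..s, v τ (γ τ) with hP
  set Γ : ℕ → ℝ → E := fun n => P^[n] (fun _ => x) with hΓ
  have hΓs : ∀ n, Γ (n + 1) = P (Γ n) := fun n => Function.iterate_succ_apply' P n _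
  have hΓc : ∀ n, ContinuousOn (Γ n) I := by
    intro n
    induction n with
    | zero => exact continuousOn_const
    | succ n ih =>
      rw [hΓs]
      exact continuousOn_const.add
        (continuousOn_primitive_of_forall_intervalIntegrable hI ht (hint _ ih))
  set Λ : ℝ → ℝ := fun s => |∫ τ in t..s, L τ| with hΛ
  set K : ℝ → ℝ := fun s => |∫ τ in t..s, ‖v τ x‖| with hK
  have hmono : ∀ f : ℝ → ℝ, (∀ τ, 0 ≤ f τ) → (∀ a ∈ I, ∀ b ∈ I, IntervalIntegrable f volume a b) →
      ∀ s ∈ I, ∀ τ ∈ uIoc t s, |∫ σ in t..τ, f σ| ≤ |∫ σ in t..s, f σ| := by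
    intro f hf0 hf s hs τ hτ
    refine intervalIntegral.abs_integral_mono_interval ?_ (ae_of_all _ hf0) (hf t ht s hs)
    exact uIoc_subset_uIoc_of_uIcc_subset_uIcc (uIcc_subset_uIcc_left (uIoc_subset_uIcc hτ))
  -- The first increment costs `K`, and each further iteration gains a factor `Λ / (n + 1)`. The
  -- absolute values in `K` and `Λ` serve times before `t`.
  have hstep : ∀ n, ∀ s ∈ I, ‖Γ (n + 1) s - Γ n s‖ ≤ K s * (Λ s ^ n / n.factorial) := by
    intro n
    induction n with
    | zero =>
      intro s hs
      rw [hΓs]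
      simp only [hP, hΓ, Function.iterate_zero, id, add_sub_cancel_left, pow_zero,
        Nat.factorial_zero, Nat.cast_one, div_one, mul_one]
      exact intervalIntegral.norm_integral_le_abs_integral_norm
    | succ n ih =>
      intro s hs
      rw [show Γ (n + 1 + 1) s = x + ∫ τ in t..s, v τ (Γ (n + 1) τ) by rw [hΓs],
        show Γ (n + 1) s = x + ∫ τ in t..s, v τ (Γ n τ) by rw [hΓs], add_sub_add_left_eq_sub,
        ← intervalIntegral.integral_sub (hint _ (hΓc _) t ht s hs)
        (hint _ (hΓc _) t ht s hs)]
      have hcontΛ : ContinuousOn Λ I :=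
        (continuousOn_primitive_of_forall_intervalIntegrable hI ht hL).abs
      have hgi : IntervalIntegrable (fun τ => K s / n.factorial * (L τ * Λ τ ^ n)) volume t s :=
        ((hL t ht s hs).mul_continuousOn
          ((hcontΛ.mono (hIc.uIcc_subset ht hs)).pow n)).const_mul _
      refine (intervalIntegral.norm_integral_le_abs_of_norm_le ?_ hgi).trans (le_of_eq ?_)
      · filter_upwards [hvs t ht s hs, ae_restrict_mem measurableSet_uIoc] with τ hτ hmem
        refine (hτ _ _).trans ?_
        have h1 := ih τ (hsub t ht s hs hmem)
        have h2 : K τ ≤ K s := hmono (fun τ => ‖v τ x‖) (fun _ => norm_nonneg _)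
          (fun a ha b hb => (hv0 x a ha b hb).norm) s hs τ hmem
        have h3 : 0 ≤ Λ τ ^ n / n.factorial := by positivity
        calc L τ * ‖Γ (n + 1) τ - Γ n τ‖ ≤ L τ * (K s * (Λ τ ^ n / n.factorial)) :=
              mul_le_mul_of_nonneg_left (h1.trans (mul_le_mul_of_nonneg_right h2 h3)) (hL0 τ)
          _ = _ := by ring
      · rw [intervalIntegral.integral_const_mul, abs_mul, hΛ,
          abs_integral_mul_abs_primitive_pow hL0 (hL t ht s hs), Nat.factorial_succ,
          abs_of_nonneg (by positivity)]
        push_cast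
        field_simp
  have hsum : ∀ s, Summable fun n : ℕ => K s * (Λ s ^ n / n.factorial) := fun s =>
    (Real.summable_pow_div_factorial (Λ s)).mul_left _
  have hdist : ∀ s ∈ I, ∀ n, dist (Γ n s) (Γ n.succ s) ≤ K s * (Λ s ^ n / n.factorial) := by
    intro s hs n
    rw [dist_comm, dist_eq_norm]
    exact hstep n s hs
  have hlim : ∀ s ∈ I, ∃ y, Tendsto (fun n => Γ n s) atTop (𝓝 y) := fun s hs =>
    cauchySeq_tendsto_of_complete
      (cauchySeq_of_dist_le_of_summable _ (hdist s hs) (hsum s))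
  choose! γ hγ using hlim
  have htot : ∀ s ∈ I, ∀ n, ‖Γ n s - x‖ ≤ K s * Real.exp (Λ s) := by
    intro s hs n
    have h1 : dist (Γ 0 s) (Γ n s) ≤ ∑ i ∈ Finset.range n, K s * (Λ s ^ i / i.factorial) :=
      dist_le_range_sum_of_dist_le (f := fun n => Γ n s) n fun _ => hdist s hs _
    rw [← dist_eq_norm, dist_comm]
    refine h1.trans ?_
    rw [← Finset.mul_sum]
    exact mul_le_mul_of_nonneg_left (Real.sum_le_exp_of_nonneg (abs_nonneg _) n) (abs_nonneg _)
  -- An integrable majorant independent of `n`, for dominated convergence in the integral equation.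
  have hLip : ∀ s ∈ I, ∀ᵐ τ ∂(volume.restrict (uIoc t s)), ∀ n,
      ‖v τ (Γ n τ)‖ ≤ ‖v τ x‖ + L τ * (K s * Real.exp (Λ s)) := by
    intro s hs
    filter_upwards [hvs t ht s hs, ae_restrict_mem measurableSet_uIoc] with τ hτ hmem n
    have h1 := hτ (Γ n τ) x
    have h2 : K τ ≤ K s := hmono (fun τ => ‖v τ x‖) (fun _ => norm_nonneg _)
      (fun a ha b hb => (hv0 x a ha b hb).norm) s hs τ hmem
    have h3 : Λ τ ≤ Λ s := hmono L hL0 hL s hs τ hmem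
    have h4 : ‖Γ n τ - x‖ ≤ K s * Real.exp (Λ s) := by
      refine (htot τ (hsub t ht s hs hmem) n).trans ?_
      have : 0 ≤ K s := abs_nonneg _
      gcongr
    have h5 := mul_le_mul_of_nonneg_left h4 (hL0 τ)
    have h6 := norm_sub_norm_le (v τ (Γ n τ)) (v τ x)
    linarith
  have hconv : ∀ s ∈ I, ∀ᵐ τ ∂(volume.restrict (uIoc t s)),
      Tendsto (fun n => v τ (Γ n τ)) atTop (𝓝 (v τ (γ τ))) := by
    intro s hs
    filter_upwards [hvs t ht s hs, ae_restrict_mem measurableSet_uIoc] with τ hτ hmem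
    have h1 := hγ τ (hsub t ht s hs hmem)
    rw [tendsto_iff_norm_sub_tendsto_zero] at h1 ⊢
    refine squeeze_zero (fun _ => norm_nonneg _) (fun n => hτ _ _) ?_
    simpa using h1.const_mul (L τ)
  refine ⟨γ, fun s hs => ?_⟩
  have hbi : IntervalIntegrable (fun τ => ‖v τ x‖ + L τ * (K s * Real.exp (Λ s))) volume t s :=
    (hv0 x t ht s hs).norm.add ((hL t ht s hs).mul_const _)
  have hmeas : ∀ n, AEStronglyMeasurable (fun τ => v τ (Γ n τ)) (volume.restrict (uIoc t s)) :=
    fun n => (hm _ (hΓc n)).mono_measure (Measure.restrict_mono (hsub t ht s hs) le_rfl)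
  constructor
  · refine hbi.mono_fun' (aestronglyMeasurable_of_tendsto_ae atTop hmeas (hconv s hs)) ?_
    filter_upwards [hLip s hs, hconv s hs] with τ h1 h2
    exact le_of_tendsto h2.norm (Eventually.of_forall h1)
  · have h1 : Tendsto (fun n => ∫ τ in t..s, v τ (Γ n τ)) atTop (𝓝 (∫ τ in t..s, v τ (γ τ))) := by
      refine intervalIntegral.tendsto_integral_filter_of_dominated_convergence _
        (Eventually.of_forall hmeas) (Eventually.of_forall fun n => ?_) hbi ?_
      · have := hLip s hs
        rw [ae_restrict_iff' measurableSet_uIoc] at this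
        filter_upwards [this] with τ hτ hmem using hτ hmem n
      · have := hconv s hs
        rw [ae_restrict_iff' measurableSet_uIoc] at this
        exact this
    have h2 : Tendsto (fun n => Γ (n + 1) s) atTop (𝓝 (x + ∫ τ in t..s, v τ (γ τ))) := by
      simp_rw [hΓs]
      exact h1.const_add x
    exact tendsto_nhds_unique ((tendsto_add_atTop_iff_nat 1).2 (hγ s hs)) h2

end Caratheodory

/-! ### Existence of the mollified flow -/

section Flow

variable {d : ℕ} {S T : EReal} {p : ℝ≥0∞} {φ : Space d → ℝ} {u : ℝ → Space d → Space d}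
  {G : ℝ → Space d → Space d →L[ℝ] Space d}

/-- The flow is defined by choice, so existence of some solution makes it one. The later comparison
estimates hold for any solution. -/
theorem MemL1LocHomSobolev.isMollifiedTrajectory_mollifiedFlow (hu : MemL1LocHomSobolev S T p u G)
    (hp : 1 ≤ p) (hφ : IsMollifier φ) {ε : ℝ} (hε : 0 < ε) {t : ℝ} (ht : t ∈ timeInterval S T)
    (x : Space d) :
    IsMollifiedTrajectory φ S T u ε t x (mollifiedFlow φ S T u ε t x) := by
  obtain ⟨L, hLm, hLi, hLip⟩ := hu.exists_lipschitz_bound hp hφ hε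
  refine Classical.epsilon_spec (p := IsMollifiedTrajectory φ S T u ε t x) ?_
  have hLae : ∀ a b : ℝ, Icc a b ⊆ timeInterval S T →
      ∀ᵐ τ ∂(volume.restrict (Icc a b)), L τ < ∞ := fun a b hab =>
    ae_lt_top hLm (hLi a b hab).ne
  -- Integrability is known only on compact subintervals; countably many with rational endpoints
  -- cover the interval.
  have hfin : ∀ᵐ τ ∂(volume.restrict (timeInterval S T)), L τ < ∞ := by
    have hcover : timeInterval S T ⊆ ⋃ q : {q : ℚ × ℚ // Icc (q.1 : ℝ) q.2 ⊆ timeInterval S T},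
        Icc (q.1.1 : ℝ) q.1.2 := by
      intro s hs
      obtain ⟨δ, hδ, hball⟩ := Metric.isOpen_iff.1 (isOpen_timeInterval S T) s hs
      obtain ⟨q₁, h1, h2⟩ := exists_rat_btwn (show s - δ < s by linarith)
      obtain ⟨q₂, h3, h4⟩ := exists_rat_btwn (show s < s + δ by linarith)
      refine mem_iUnion.2 ⟨⟨(q₁, q₂), fun r hr => hball ?_⟩, h2.le, h3.le⟩
      rw [mem_ball, Real.dist_eq, abs_lt]
      constructor <;> linarith [hr.1, hr.2]
    refine ae_restrict_of_ae_restrict_of_subset hcover ?_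
    rw [ae_restrict_iUnion_iff]
    exact fun q => hLae _ _ q.2
  refine exists_caratheodory_solution (isOpen_timeInterval S T) (ordConnected_timeInterval S T)
    (L := fun τ => (L τ).toReal) (fun _ => ENNReal.toReal_nonneg) ?_ ?_ ?_ ?_ ht x
  · intro a ha b hb
    have hsub := uIcc_subset_timeInterval ha hb
    rw [intervalIntegrable_iff]
    refine integrable_toReal_of_lintegral_ne_top hLm.aemeasurable ?_
    exact ((lintegral_mono_set uIoc_subset_uIcc).trans_lt (hLi _ _ hsub)).ne
  · filter_upwards [hLip, hfin] with τ hτ hτf y z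
    have h := ENNReal.toReal_mono (ENNReal.mul_ne_top hτf.ne enorm_ne_top) (hτ y z)
    rwa [ENNReal.toReal_mul, toReal_enorm, toReal_enorm] at h
  · exact fun y a ha b hb => hu.intervalIntegrable_mollifiedVelocity hφ hε y ha hb
  · exact fun γ hγ => aestronglyMeasurable_mollifiedVelocity_comp hφ hu.aestronglyMeasurable ε hγ

end Flow

/-! ### Comparison of center curves -/

section Comparison

variable {d : ℕ}

/-- `γ` is an integral curve of `V` on `I`, in integrated form. -/
structure IsIntegratedCurve (I : Set ℝ) (V : ℝ → Space d → Space d) (γ : ℝ → Space d) : Prop where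
  continuousOn : ContinuousOn γ I
  intervalIntegrable : ∀ a ∈ I, ∀ b ∈ I, IntervalIntegrable (fun τ => V τ (γ τ)) volume a b
  sub_eq : ∀ a ∈ I, ∀ b ∈ I, γ b - γ a = ∫ τ in a..b, V τ (γ τ)

lemma IsMollifiedTrajectory.isIntegratedCurve {S T : EReal} {φ : Space d → ℝ}
    {u : ℝ → Space d → Space d} {ε t : ℝ} {x : Space d} {γ : ℝ → Space d}
    (ht : t ∈ timeInterval S T) (h : IsMollifiedTrajectory φ S T u ε t x γ) :
    IsIntegratedCurve (timeInterval S T) (mollifiedVelocity φ u ε) γ := by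
  have hint : ∀ a ∈ timeInterval S T, ∀ b ∈ timeInterval S T,
      IntervalIntegrable (fun τ => mollifiedVelocity φ u ε τ (γ τ)) volume a b :=
    fun a ha b hb => (h a ha).1.symm.trans (h b hb).1
  refine ⟨?_, hint, fun a ha b hb => ?_⟩
  · refine (continuousOn_const.add (continuousOn_primitive_of_forall_intervalIntegrable
      (isOpen_timeInterval S T) ht hint)).congr fun s hs => (h s hs).2
  · rw [(h a ha).2, (h b hb).2, add_sub_add_left_eq_sub,
      intervalIntegral.integral_interval_sub_left (h b hb).1 (h a ha).1]

lemma IsMollifiedTrajectory.apply_self {S T : EReal} {φ : Space d → ℝ}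
    {u : ℝ → Space d → Space d} {ε t : ℝ} {x : Space d} {γ : ℝ → Space d}
    (ht : t ∈ timeInterval S T) (h : IsMollifiedTrajectory φ S T u ε t x γ) : γ t = x := by
  simpa using (h t ht).2

/-- The mean of `m s` over the ball of radius `ε` around `γ s`. -/
noncomputable def ballMean (m : ℝ → Space d → ℝ≥0∞) (γ : ℝ → Space d) (ε s : ℝ) : ℝ≥0∞ :=
  (volume (ball (0 : Space d) ε))⁻¹ * ∫⁻ y in ball (γ s) ε, m s y

/-- Averaging in `y` an inequality whose left side does not depend on `y`. Truncated subtraction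
moves `B` across without assuming it finite. -/
lemma le_mul_ballMean_add {m : ℝ → Space d → ℝ≥0∞} {γ : ℝ → Space d} {ε s : ℝ} (hε : 0 < ε)
    {c α B : ℝ≥0∞} (hα : α ≠ ∞) (h : ∀ y ∈ ball (γ s) ε, c ≤ α * m s y + B) :
    c ≤ α * ballMean m γ ε s + B := by
  rw [← tsub_le_iff_right]
  have hV : volume (ball (0 : Space d) ε) ≠ 0 := (measure_ball_pos _ _ hε).ne'
  have hV' : volume (ball (0 : Space d) ε) ≠ ∞ := measure_ball_lt_top.ne
  calc c - B = (volume (ball (0 : Space d) ε))⁻¹ * ((c - B) * volume (ball (γ s) ε)) := by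
        rw [Measure.addHaar_ball_center volume (γ s) ε, mul_comm (c - B), ← mul_assoc,
          ENNReal.inv_mul_cancel hV hV', one_mul]
    _ = (volume (ball (0 : Space d) ε))⁻¹ * ∫⁻ _ in ball (γ s) ε, (c - B) := by
        rw [setLIntegral_const]
    _ ≤ (volume (ball (0 : Space d) ε))⁻¹ * ∫⁻ y in ball (γ s) ε, α * m s y := by
        gcongr (volume (ball (0 : Space d) ε))⁻¹ * ?_
        refine setLIntegral_mono' measurableSet_ball fun y hy => ?_
        exact tsub_le_iff_right.2 (h y hy)
    _ = α * ballMean m γ ε s := by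
        rw [lintegral_const_mul' _ _ hα, ballMean]
        ring

/-- `m` controls the increments of the velocities `V ε` in the scale and in space. -/
def ControlsIncrements (I : Set ℝ) (V : ℝ → ℝ → Space d → Space d) (m : ℝ → Space d → ℝ≥0∞)
    (C : ℝ≥0) : Prop :=
  ∀ᵐ τ ∂(volume.restrict I), ∀ (ρ ρ' : ℝ) (x x' y y' : Space d), 0 < ρ → 0 < ρ' →
    (∀ r ∈ uIcc ρ ρ', ‖y - x‖ ≤ 6 * r) → (∀ p ∈ segment ℝ x x', ‖y' - p‖ ≤ 6 * ρ') →
    ‖V ρ τ x - V ρ' τ x'‖ₑ ≤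
      C * (ENNReal.ofReal |ρ - ρ'| * m τ y + ENNReal.ofReal ‖x - x'‖ * m τ y')

/-- A curve of the scale `ε` along which the means of `m` have a small integral over the time
interval of length `2 ε ^ 2` around `t`. -/
structure IsTameCurve (I : Set ℝ) (V : ℝ → ℝ → Space d → Space d) (m : ℝ → Space d → ℝ≥0∞)
    (θ : ℝ≥0) (ε t : ℝ) (γ : ℝ → Space d) : Prop extends IsIntegratedCurve I (V ε) γ where
  pos : 0 < ε
  mem : t ∈ I
  Ioo_subset : Ioo (t - ε ^ 2) (t + ε ^ 2) ⊆ I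
  aemeasurable_ballMean :
    AEMeasurable (ballMean m γ ε) (volume.restrict (Ioo (t - ε ^ 2) (t + ε ^ 2)))
  lintegral_ballMean_le : ∫⁻ s in Ioo (t - ε ^ 2) (t + ε ^ 2), ballMean m γ ε s ≤ θ

/-- The continuity method, in either time direction: at the point nearest to `a` where `g` reaches
`c`, the bound `g ≤ c` holds on the way, so the hypothesis contradicts the choice of the point. -/
lemma lt_of_forall_le_imp_lt {g : ℝ → ℝ} {a b c : ℝ} (hg : ContinuousOn g (uIcc a b))
    (h0 : g a < c) (h : ∀ s ∈ uIcc a b, (∀ r ∈ uIcc a s, g r ≤ c) → g s < c) :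
    ∀ s ∈ uIcc a b, g s < c := by
  by_contra! hne
  set Z := {s ∈ uIcc a b | c ≤ g s} with hZ
  have hZc : IsCompact Z := by
    have : Z = uIcc a b ∩ g ⁻¹' Ici c := rfl
    rw [this]
    exact isCompact_uIcc.of_isClosed_subset
      (hg.preimage_isClosed_of_isClosed isClosed_Icc isClosed_Ici) inter_subset_left
  obtain ⟨s₀, hs₀, hmin⟩ := hZc.exists_isMinOn (f := fun s => |s - a|)
    (let ⟨s, hs, hc⟩ := hne; ⟨s, hs, hc⟩) (by fun_prop)
  have hlt : ∀ r ∈ uIcc a s₀, r ≠ s₀ → g r < c := by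
    intro r hr hne
    by_contra! hcr
    have h1 : |s₀ - a| ≤ |r - a| := hmin ⟨uIcc_subset_uIcc_left hs₀.1 hr, hcr⟩
    apply hne
    rcases le_total a s₀ with has | has
    · rw [uIcc_of_le has] at hr
      rw [abs_of_nonneg (by linarith), abs_of_nonneg (by linarith [hr.1])] at h1
      linarith [hr.2]
    · rw [uIcc_of_ge has] at hr
      rw [abs_of_nonpos (by linarith), abs_of_nonpos (by linarith [hr.2])] at h1
      linarith [hr.1]
  have heq : g s₀ ≤ c := by
    by_contra! hgt
    obtain ⟨r, hr, hrc⟩ := intermediate_value_uIcc (hg.mono (uIcc_subset_uIcc_left hs₀.1))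
      (show c ∈ uIcc (g a) (g s₀) by rw [uIcc_of_le (h0.trans hgt).le]; exact ⟨h0.le, hgt.le⟩)
    have hne : r ≠ s₀ := by rintro rfl; exact hgt.ne' hrc
    exact (hlt r hr hne).ne hrc
  refine (h s₀ hs₀.1 fun r hr => ?_).not_ge hs₀.2
  rcases eq_or_ne r s₀ with rfl | hne
  · exact heq
  · exact (hlt r hr hne).le

variable {I : Set ℝ} {V : ℝ → ℝ → Space d → Space d} {m : ℝ → Space d → ℝ≥0∞} {C θ : ℝ≥0}

lemma IsIntegratedCurve.enorm_sub_sub_le {V₁ V₂ : ℝ → Space d → Space d} {γ₁ γ₂ : ℝ → Space d}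
    (h₁ : IsIntegratedCurve I V₁ γ₁) (h₂ : IsIntegratedCurve I V₂ γ₂) {σ s : ℝ} (hσ : σ ∈ I)
    (hs : s ∈ I) {M : ℝ → ℝ≥0∞}
    (hM : ∀ᵐ τ ∂(volume.restrict (uIoc σ s)), ‖V₁ τ (γ₁ τ) - V₂ τ (γ₂ τ)‖ₑ ≤ M τ) :
    ‖(γ₁ s - γ₂ s) - (γ₁ σ - γ₂ σ)‖ₑ ≤ ∫⁻ τ in uIoc σ s, M τ := by
  have h : (γ₁ s - γ₂ s) - (γ₁ σ - γ₂ σ) = ∫ τ in σ..s, (V₁ τ (γ₁ τ) - V₂ τ (γ₂ τ)) := by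
    rw [intervalIntegral.integral_sub (h₁.intervalIntegrable σ hσ s hs)
      (h₂.intervalIntegrable σ hσ s hs), ← h₁.sub_eq σ hσ s hs, ← h₂.sub_eq σ hσ s hs]
    abel
  rw [h, ← ofReal_norm, intervalIntegral.norm_intervalIntegral_eq, ofReal_norm]
  exact (enorm_integral_le_lintegral_enorm _).trans (lintegral_mono_ae hM)

/-- Comparison times may be endpoints of an open lifespan; the endpoints are null, so inclusion of
the open interval suffices. -/
lemma uIoc_ae_le {J : Set ℝ} {σ s : ℝ} (h : Ioo (min σ s) (max σ s) ⊆ J) :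
    uIoc σ s ≤ᵐ[volume] J :=
  (Ioo_ae_eq_Ioc (μ := volume)).symm.le.trans (LE.le.eventuallyLE h)

lemma setLIntegral_uIoc_le {J : Set ℝ} {σ s : ℝ} (h : Ioo (min σ s) (max σ s) ⊆ J)
    (f : ℝ → ℝ≥0∞) : ∫⁻ τ in uIoc σ s, f τ ≤ ∫⁻ τ in J, f τ :=
  lintegral_mono' (Measure.restrict_mono' (uIoc_ae_le h) le_rfl) le_rfl

lemma Ioo_subset_of_mem_uIcc {J : Set ℝ} {σ s r : ℝ} (h : Ioo (min σ s) (max σ s) ⊆ J)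
    (hr : r ∈ uIcc σ s) : Ioo (min σ r) (max σ r) ⊆ J := by
  refine (Ioo_subset_Ioo ?_ ?_).trans h
  · exact le_min (min_le_left _ _) hr.1
  · exact max_le (le_max_left _ _) hr.2

/-- Two tame curves at comparable scales stay close to each other during their common
lifespan. -/
lemma IsTameCurve.norm_sub_sub_lt (hI : I.OrdConnected) (hV : ControlsIncrements I V m C)
    (hθ : 100 * C * θ ≤ 1) {ε₁ ε₂ t₁ t₂ : ℝ} {γ₁ γ₂ : ℝ → Space d}
    (h₁ : IsTameCurve I V m θ ε₁ t₁ γ₁) (h₂ : IsTameCurve I V m θ ε₂ t₂ γ₂) (hε : ε₁ ≤ 2 * ε₂)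
    {σ s : ℝ} (hσ : σ ∈ I) (hs : s ∈ I)
    (hJ₁ : Ioo (min σ s) (max σ s) ⊆ Ioo (t₁ - ε₁ ^ 2) (t₁ + ε₁ ^ 2))
    (hJ₂ : Ioo (min σ s) (max σ s) ⊆ Ioo (t₂ - ε₂ ^ 2) (t₂ + ε₂ ^ 2))
    (hD : ‖γ₁ σ - γ₂ σ‖ ≤ 4 * ε₂) :
    ‖(γ₁ s - γ₂ s) - (γ₁ σ - γ₂ σ)‖ < ε₂ / 4 := by
  have hε₁ := h₁.pos
  have hε₂ := h₂.pos
  have hsub := hI.uIcc_subset hσ hs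
  have hcont : ContinuousOn (fun r => ‖(γ₁ r - γ₂ r) - (γ₁ σ - γ₂ σ)‖) (uIcc σ s) :=
    (((h₁.continuousOn.sub h₂.continuousOn).mono hsub).sub continuousOn_const).norm
  refine lt_of_forall_le_imp_lt hcont (by simpa using by positivity) (fun r hr hle => ?_) s
    right_mem_uIcc
  have hrI : r ∈ I := hsub hr
  have hJ₁' := Ioo_subset_of_mem_uIcc hJ₁ hr
  have hJ₂' := Ioo_subset_of_mem_uIcc hJ₂ hr
  have hae : ∀ᵐ τ ∂(volume.restrict (uIoc σ r)), ‖V ε₁ τ (γ₁ τ) - V ε₂ τ (γ₂ τ)‖ₑ ≤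
      C * (ENNReal.ofReal (5 * ε₂) * ballMean m γ₁ ε₁ τ +
        ENNReal.ofReal (5 * ε₂) * ballMean m γ₂ ε₂ τ) := by
    have h3 : ∀ᵐ τ ∂(volume.restrict (uIoc σ r)), _ :=
      ae_mono (Measure.restrict_mono (uIoc_subset_uIcc.trans (hI.uIcc_subset hσ hrI)) le_rfl) hV
    filter_upwards [h3, ae_restrict_mem measurableSet_uIoc] with τ hτ hmem
    have hdist : ‖γ₁ τ - γ₂ τ‖ ≤ 5 * ε₂ := by
      have h4 := hle τ (uIoc_subset_uIcc hmem)
      have h5 := norm_add_le ((γ₁ τ - γ₂ τ) - (γ₁ σ - γ₂ σ)) (γ₁ σ - γ₂ σ)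
      rw [sub_add_cancel] at h5
      linarith
    have habs : |ε₁ - ε₂| ≤ 5 * ε₂ := by
      rw [abs_le]; constructor <;> linarith
    -- The curves are at most `5 ε₂` apart and `y'` adds at most `ε₂`: this is the origin of the
    -- factor `6`. The points `y` and `y'` are then averaged out one after the other.
    have hpt : ∀ y ∈ ball (γ₁ τ) ε₁, ∀ y' ∈ ball (γ₂ τ) ε₂,
        ‖V ε₁ τ (γ₁ τ) - V ε₂ τ (γ₂ τ)‖ₑ ≤
          (C * ENNReal.ofReal (5 * ε₂)) * m τ y + (C * ENNReal.ofReal (5 * ε₂)) * m τ y' := by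
      intro y hy y' hy'
      rw [mem_ball, dist_eq_norm] at hy hy'
      refine (hτ ε₁ ε₂ (γ₁ τ) (γ₂ τ) y y' hε₁ hε₂ ?_ ?_).trans ?_
      · intro r hr
        have : ε₁ ≤ 2 * r := by
          rcases le_total ε₁ ε₂ with h | h
          · rw [uIcc_of_le h] at hr; linarith [hr.1]
          · rw [uIcc_of_ge h] at hr; linarith [hr.1]
        linarith
      · intro p hp
        have h6 : ‖p - γ₂ τ‖ ≤ 5 * ε₂ := by
          have := (convex_closedBall (γ₂ τ) (5 * ε₂)).segment_subset
            (show γ₁ τ ∈ closedBall (γ₂ τ) (5 * ε₂) by rwa [mem_closedBall, dist_eq_norm])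
            (mem_closedBall_self (by positivity)) hp
          rwa [mem_closedBall, dist_eq_norm] at this
        have h7 := norm_sub_le_norm_sub_add_norm_sub y' (γ₂ τ) p
        rw [norm_sub_rev (γ₂ τ) p] at h7
        linarith
      · rw [mul_assoc, mul_assoc, ← mul_add]
        gcongr
    have hfin : (C : ℝ≥0∞) * ENNReal.ofReal (5 * ε₂) ≠ ∞ := by finiteness
    have h8 : ∀ y' ∈ ball (γ₂ τ) ε₂, ‖V ε₁ τ (γ₁ τ) - V ε₂ τ (γ₂ τ)‖ₑ ≤
        (C * ENNReal.ofReal (5 * ε₂)) * m τ y' +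
          (C * ENNReal.ofReal (5 * ε₂)) * ballMean m γ₁ ε₁ τ := fun y' hy' => by
      rw [add_comm]
      exact le_mul_ballMean_add hε₁ hfin fun y hy => hpt y hy y' hy'
    refine (le_mul_ballMean_add hε₂ hfin h8).trans (le_of_eq ?_)
    ring
  have hfin5 : ENNReal.ofReal (5 * ε₂) ≠ ∞ := ENNReal.ofReal_ne_top
  have hmain : ‖(γ₁ r - γ₂ r) - (γ₁ σ - γ₂ σ)‖ₑ ≤
      C * (ENNReal.ofReal (5 * ε₂) * θ + ENNReal.ofReal (5 * ε₂) * θ) := by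
    refine (h₁.toIsIntegratedCurve.enorm_sub_sub_le h₂.toIsIntegratedCurve hσ hrI hae).trans ?_
    have hm₁ : AEMeasurable (ballMean m γ₁ ε₁) (volume.restrict (uIoc σ r)) :=
      h₁.aemeasurable_ballMean.mono_measure (Measure.restrict_mono' (uIoc_ae_le hJ₁') le_rfl)
    rw [lintegral_const_mul' _ _ ENNReal.coe_ne_top, lintegral_add_left' (hm₁.const_mul _),
      lintegral_const_mul' _ _ hfin5, lintegral_const_mul' _ _ hfin5]
    gcongr
    · exact (setLIntegral_uIoc_le hJ₁' _).trans h₁.lintegral_ballMean_le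
    · exact (setLIntegral_uIoc_le hJ₂' _).trans h₂.lintegral_ballMean_le
  have hreal : ‖(γ₁ r - γ₂ r) - (γ₁ σ - γ₂ σ)‖ ≤ C * (5 * ε₂ * θ + 5 * ε₂ * θ) := by
    rw [← ofReal_norm, ← ENNReal.ofReal_coe_nnreal (p := C), ← ENNReal.ofReal_coe_nnreal (p := θ),
      ← ENNReal.ofReal_mul (by positivity), ← ENNReal.ofReal_add (by positivity) (by positivity),
      ← ENNReal.ofReal_mul (by positivity)] at hmain
    exact (ENNReal.ofReal_le_ofReal_iff (by positivity)).1 hmain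
  -- The displacement is at most `10 C θ ε₂ ≤ ε₂ / 10`, strictly below the threshold `ε₂ / 4`.
  have hθ' : 100 * (C : ℝ) * θ ≤ 1 := by exact_mod_cast hθ
  have h9 := mul_le_mul_of_nonneg_left hθ' hε₂.le
  nlinarith

/-- A curve at a scale and with initial data close to those of a tame curve stays close to it. -/
lemma IsTameCurve.norm_sub_lt (hI : I.OrdConnected) (hV : ControlsIncrements I V m C)
    (hθ : 100 * C * θ ≤ 1) {ε₁ ε₂ t₂ : ℝ} {γ₁ γ₂ : ℝ → Space d}
    (h₁ : IsIntegratedCurve I (V ε₁) γ₁) (h₂ : IsTameCurve I V m θ ε₂ t₂ γ₂)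
    (hε₁ : ε₂ / 2 ≤ ε₁) (hε₁' : ε₁ ≤ ε₂) {σ s κ : ℝ} (hσ : σ ∈ I) (hs : s ∈ I)
    (hJ : Ioo (min σ s) (max σ s) ⊆ Ioo (t₂ - ε₂ ^ 2) (t₂ + ε₂ ^ 2))
    (hκ : 0 < κ) (hκε : 2 * κ ≤ ε₂) (hD : ‖γ₁ σ - γ₂ σ‖ + |ε₁ - ε₂| ≤ κ) :
    ‖γ₁ s - γ₂ s‖ < 2 * κ := by
  have hε₂ := h₂.pos
  have hε₀ : 0 < ε₁ := by linarith
  have hsub := hI.uIcc_subset hσ hs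
  have hcont : ContinuousOn (fun r => ‖γ₁ r - γ₂ r‖) (uIcc σ s) :=
    ((h₁.continuousOn.sub h₂.continuousOn).mono hsub).norm
  refine lt_of_forall_le_imp_lt hcont (by linarith [abs_nonneg (ε₁ - ε₂)]) (fun r hr hle => ?_) s
    right_mem_uIcc
  have hrI : r ∈ I := hsub hr
  have hJ' := Ioo_subset_of_mem_uIcc hJ hr
  have hfin : (C : ℝ≥0∞) * ENNReal.ofReal (3 * κ) ≠ ∞ := by finiteness
  have hae : ∀ᵐ τ ∂(volume.restrict (uIoc σ r)), ‖V ε₁ τ (γ₁ τ) - V ε₂ τ (γ₂ τ)‖ₑ ≤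
      C * ENNReal.ofReal (3 * κ) * ballMean m γ₂ ε₂ τ := by
    have h3 : ∀ᵐ τ ∂(volume.restrict (uIoc σ r)), _ :=
      ae_mono (Measure.restrict_mono (uIoc_subset_uIcc.trans (hI.uIcc_subset hσ hrI)) le_rfl) hV
    filter_upwards [h3, ae_restrict_mem measurableSet_uIoc] with τ hτ hmem
    have hdist : ‖γ₁ τ - γ₂ τ‖ ≤ 2 * κ := hle τ (uIoc_subset_uIcc hmem)
    -- Only `γ₂` is tame, so a single point `y` of its ball serves both the scale and the space
    -- increment, of total size at most `κ + 2 κ`.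
    have hpt : ∀ y ∈ ball (γ₂ τ) ε₂, ‖V ε₁ τ (γ₁ τ) - V ε₂ τ (γ₂ τ)‖ₑ ≤
        (C * ENNReal.ofReal (3 * κ)) * m τ y + 0 := by
      intro y hy
      rw [mem_ball, dist_eq_norm] at hy
      refine (hτ ε₁ ε₂ (γ₁ τ) (γ₂ τ) y y hε₀ hε₂ ?_ ?_).trans ?_
      · intro r hr
        rw [uIcc_of_le hε₁'] at hr
        have h7 := norm_sub_le_norm_sub_add_norm_sub y (γ₂ τ) (γ₁ τ)
        rw [norm_sub_rev (γ₂ τ)] at h7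
        linarith [hr.1]
      · intro p hp
        have h6 : ‖p - γ₂ τ‖ ≤ ε₂ := by
          have := (convex_closedBall (γ₂ τ) ε₂).segment_subset
            (show γ₁ τ ∈ closedBall (γ₂ τ) ε₂ by
              rw [mem_closedBall, dist_eq_norm]; linarith)
            (mem_closedBall_self hε₂.le) hp
          rwa [mem_closedBall, dist_eq_norm] at this
        have h7 := norm_sub_le_norm_sub_add_norm_sub y (γ₂ τ) p
        rw [norm_sub_rev (γ₂ τ) p] at h7
        linarith
      · rw [add_zero, mul_assoc, ← add_mul, ← ENNReal.ofReal_add (abs_nonneg _) (norm_nonneg _)]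
        gcongr
        linarith [norm_nonneg (γ₁ σ - γ₂ σ)]
    simpa using le_mul_ballMean_add hε₂ hfin hpt
  have hmain : ‖(γ₁ r - γ₂ r) - (γ₁ σ - γ₂ σ)‖ₑ ≤ C * ENNReal.ofReal (3 * κ) * θ := by
    refine (h₁.enorm_sub_sub_le h₂.toIsIntegratedCurve hσ hrI hae).trans ?_
    rw [lintegral_const_mul' _ _ hfin]
    gcongr
    exact (setLIntegral_uIoc_le hJ' _).trans h₂.lintegral_ballMean_le
  have hreal : ‖(γ₁ r - γ₂ r) - (γ₁ σ - γ₂ σ)‖ ≤ C * (3 * κ) * θ := by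
    rw [← ofReal_norm, ← ENNReal.ofReal_coe_nnreal (p := C), ← ENNReal.ofReal_coe_nnreal (p := θ),
      ← ENNReal.ofReal_mul (by positivity), ← ENNReal.ofReal_mul (by positivity)] at hmain
    exact (ENNReal.ofReal_le_ofReal_iff (by positivity)).1 hmain
  have hθ' : 100 * (C : ℝ) * θ ≤ 1 := by exact_mod_cast hθ
  have h9 := mul_le_mul_of_nonneg_left hθ' hκ.le
  have h5 := norm_add_le ((γ₁ r - γ₂ r) - (γ₁ σ - γ₂ σ)) (γ₁ σ - γ₂ σ)
  rw [sub_add_cancel] at h5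
  nlinarith [abs_nonneg (ε₁ - ε₂)]

end Comparison

/-! ### Tubes around curves and Fubini -/

section Tube

variable {d : ℕ}

/-- The tube of radius `r` around the curve `γ` over the times in `J`. -/
def tube (J : Set ℝ) (γ : ℝ → Space d) (r : ℝ) : Set (ℝ × Space d) :=
  {w | w.1 ∈ J ∧ ‖w.2 - γ w.1‖ < r}

lemma cylinder_eq_tube {φ : Space d → ℝ} {S T : EReal} {u : ℝ → Space d → Space d} (ε : ℝ)
    (z : ℝ × Space d) : cylinder φ S T u ε z =
      tube (Ioo (z.1 - ε ^ 2) (z.1 + ε ^ 2)) (mollifiedFlow φ S T u ε z.1 z.2) ε := by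
  ext w
  simp only [cylinder, tube, Set.mem_ofPred_eq, abs_lt, mem_Ioo]
  refine and_congr_left fun _ => ⟨fun h => ⟨by linarith [h.1], by linarith [h.2]⟩,
    fun h => ⟨by linarith [h.1], by linarith [h.2]⟩⟩

variable {J : Set ℝ} {γ : ℝ → Space d}

lemma isOpen_tube (hJ : IsOpen J) (hγ : ContinuousOn γ J) (r : ℝ) : IsOpen (tube J γ r) := by
  have h1 : ContinuousOn (fun w : ℝ × Space d => ‖w.2 - γ w.1‖) (J ×ˢ univ) :=
    (continuousOn_snd.sub (hγ.comp continuousOn_fst fun w hw => hw.1)).norm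
  have h2 := h1.isOpen_inter_preimage (hJ.prod isOpen_univ) (isOpen_Iio (a := r))
  convert h2 using 1
  ext w
  simp [tube]

lemma mk_mem_tube {r : ℝ} {s : ℝ} {y : Space d} :
    (s, y) ∈ tube J γ r ↔ s ∈ J ∧ y ∈ ball (γ s) r := by
  rw [mem_ball, dist_eq_norm]
  rfl

lemma indicator_tube_mk {r : ℝ} (h : ℝ × Space d → ℝ≥0∞) (s : ℝ) :
    ∫⁻ y, (tube J γ r).indicator h (s, y) =
      J.indicator (fun s => ∫⁻ y in ball (γ s) r, h (s, y)) s := by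
  by_cases hs : s ∈ J
  · rw [indicator_of_mem hs, ← lintegral_indicator measurableSet_ball]
    refine lintegral_congr fun y => ?_
    by_cases hy : y ∈ ball (γ s) r
    · rw [indicator_of_mem hy, indicator_of_mem (mk_mem_tube.2 ⟨hs, hy⟩)]
    · rw [indicator_of_notMem hy, indicator_of_notMem fun h => hy (mk_mem_tube.1 h).2]
  · rw [indicator_of_notMem hs]
    refine lintegral_eq_zero_of_ae_eq_zero (ae_of_all _ fun y => ?_)
    exact indicator_of_notMem (fun h => hs (mk_mem_tube.1 h).1) _

lemma lintegral_tube (hJ : IsOpen J) (hγ : ContinuousOn γ J) (r : ℝ) {h : ℝ × Space d → ℝ≥0∞}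
    (hh : AEMeasurable h (volume.restrict (tube J γ r))) :
    ∫⁻ w in tube J γ r, h w = ∫⁻ s in J, ∫⁻ y in ball (γ s) r, h (s, y) := by
  have hm := (isOpen_tube hJ hγ r).measurableSet
  rw [← lintegral_indicator hm, Measure.volume_eq_prod,
    lintegral_prod _ ((aemeasurable_indicator_iff hm).2 hh), ← lintegral_indicator hJ.measurableSet]
  exact lintegral_congr fun s => indicator_tube_mk h s

lemma aemeasurable_lintegral_ball (hJ : IsOpen J) (hγ : ContinuousOn γ J) (r : ℝ)
    {h : ℝ × Space d → ℝ≥0∞} (hh : AEMeasurable h (volume.restrict (tube J γ r))) :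
    AEMeasurable (fun s => ∫⁻ y in ball (γ s) r, h (s, y)) (volume.restrict J) := by
  have hm := (isOpen_tube hJ hγ r).measurableSet
  have h1 := ((aemeasurable_indicator_iff hm).2 hh)
  rw [Measure.volume_eq_prod] at h1
  have h2 := h1.lintegral_prod_right'
  simp_rw [indicator_tube_mk] at h2
  exact (aemeasurable_indicator_iff hJ.measurableSet).1 h2

/-- Every time slice is a ball of the same radius, so bending the tube does not change its volume.
-/
lemma volume_tube (hJ : IsOpen J) (hγ : ContinuousOn γ J) (r : ℝ) :
    volume (tube J γ r) = volume (ball (0 : Space d) r) * volume J := by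
  have h := lintegral_tube hJ hγ r (h := fun _ => 1) aemeasurable_const
  simpa [Measure.addHaar_ball_center] using h

end Tube

/-! ### Covering argument and weak type bound for tubes -/

section Covering

variable {d : ℕ} {I : Set ℝ} {V : ℝ → ℝ → Space d → Space d} {m : ℝ → Space d → ℝ≥0∞} {C θ : ℝ≥0}

/-- The life span of a cylinder of radius `ε` centered at the time `t`. -/
abbrev lifespan (ε t : ℝ) : Set ℝ := Ioo (t - ε ^ 2) (t + ε ^ 2)

lemma IsTameCurve.isOpen_tube {ε t : ℝ} {γ : ℝ → Space d} (h : IsTameCurve I V m θ ε t γ)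
    (r : ℝ) : IsOpen (tube (lifespan ε t) γ r) :=
  SkewedCylinder.isOpen_tube isOpen_Ioo (h.continuousOn.mono h.Ioo_subset) r

lemma IsTameCurve.volume_tube {ε t : ℝ} {γ : ℝ → Space d} (h : IsTameCurve I V m θ ε t γ)
    (r : ℝ) : volume (tube (lifespan ε t) γ r) =
      volume (ball (0 : Space d) r) * ENNReal.ofReal (2 * ε ^ 2) := by
  rw [SkewedCylinder.volume_tube isOpen_Ioo (h.continuousOn.mono h.Ioo_subset), Real.volume_Ioo]
  ring_nf

lemma volume_ball_mul {x y : Space d} {c r : ℝ} (hc : 0 < c) (hr : 0 < r) :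
    volume (ball x (c * r)) = ENNReal.ofReal (c ^ d) * volume (ball y r) := by
  rw [volume_ball_eq x (mul_pos hc hr), volume_ball_eq y hr, mul_pow,
    ENNReal.ofReal_mul (by positivity), mul_assoc]

/-- At every time, the slices of the tubes of scale at most `2 ε` that meet a given tube of
scale `ε` cover a set of measure at most a multiple of `ε ^ d`. -/
lemma IsTameCurve.volume_iUnion_slice_le (hI : I.OrdConnected) (hV : ControlsIncrements I V m C)
    (hθ : 100 * C * θ ≤ 1) {ι : Type*} {ε t : ι → ℝ} {γ : ι → ℝ → Space d} {A : Set ι}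
    (hA : ∀ a ∈ A, IsTameCurve I V m θ (ε a) (t a) (γ a)) {ε₀ t₀ : ℝ} {γ₀ : ℝ → Space d}
    (h₀ : IsTameCurve I V m θ ε₀ t₀ γ₀) (hε : ∀ a ∈ A, ε a ≤ 2 * ε₀)
    (hne : ∀ a ∈ A, (tube (lifespan (ε a) (t a)) (γ a) (ε a) ∩
      tube (lifespan ε₀ t₀) γ₀ ε₀).Nonempty) (τ : ℝ) :
    volume (⋃ a ∈ {a ∈ A | τ ∈ lifespan (ε a) (t a)}, ball (γ a τ) (ε a)) ≤
      ENNReal.ofReal (100 ^ d) * volume (ball (0 : Space d) ε₀) := by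
  have hε₀ := h₀.pos
  set B := {a ∈ A | τ ∈ lifespan (ε a) (t a)} with hB
  -- The time of the closed reference lifespan nearest to `τ`. It lies between `τ` and any meeting
  -- time `σ`: from `σ` to `τ'` curves are compared with `γ₀`, from `τ'` to `τ` only with each
  -- other.
  set τ' := max (t₀ - ε₀ ^ 2) (min (t₀ + ε₀ ^ 2) τ) with hτ'
  have hlt : t₀ - ε₀ ^ 2 < t₀ + ε₀ ^ 2 := by linarith [pow_pos hε₀ 2]
  -- the curves at the time `τ'`
  have hτ'mem : ∀ a ∈ B, τ' ∈ lifespan (ε a) (t a) ∧ ‖γ a τ' - γ₀ τ'‖ ≤ 4 * ε₀ := by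
    rintro a ⟨ha, hτ⟩
    obtain ⟨⟨σ, y⟩, ⟨hσ, hy⟩, ⟨hσ₀, hy₀⟩⟩ := hne a ha
    dsimp only at hσ hy hσ₀ hy₀
    have hle : min σ τ ≤ τ' ∧ τ' ≤ max σ τ := by
      rw [hτ']
      constructor
      · refine le_max_of_le_right (le_min ?_ (min_le_right _ _))
        exact (min_le_left _ _).trans hσ₀.2.le
      · refine max_le ?_ ((min_le_right _ _).trans (le_max_right _ _))
        exact hσ₀.1.le.trans (le_max_left _ _)
    have hτ'a : τ' ∈ lifespan (ε a) (t a) := ordConnected_Ioo.uIcc_subset hσ hτ hle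
    refine ⟨hτ'a, ?_⟩
    have hJ : Ioo (min σ τ') (max σ τ') ⊆ lifespan (ε a) (t a) :=
      Ioo_subset_Icc_self.trans (ordConnected_Ioo.uIcc_subset hσ hτ'a)
    have hJ₀ : Ioo (min σ τ') (max σ τ') ⊆ lifespan ε₀ t₀ := by
      refine Ioo_subset_Ioo (le_min hσ₀.1.le (le_max_left _ _)) (max_le hσ₀.2.le ?_)
      exact max_le hlt.le (min_le_left _ _)
    have hD : ‖γ a σ - γ₀ σ‖ ≤ 3 * ε₀ := by
      have h1 := norm_sub_le_norm_sub_add_norm_sub (γ a σ) y (γ₀ σ)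
      rw [norm_sub_rev (γ a σ) y] at h1
      linarith [hε a ha]
    have h2 := IsTameCurve.norm_sub_sub_lt hI hV hθ (hA a ha) h₀ (hε a ha)
      (h₀.Ioo_subset hσ₀) ((hA a ha).Ioo_subset hτ'a) hJ hJ₀ (by linarith)
    have h3 := norm_add_le ((γ a τ' - γ₀ τ') - (γ a σ - γ₀ σ)) (γ a σ - γ₀ σ)
    rw [sub_add_cancel] at h3
    linarith
  obtain ⟨U, hUB, hUd, hUc⟩ := Vitali.exists_disjoint_subfamily_covering_enlargement_ball B
    (fun a => γ a τ) ε (2 * ε₀) (fun a ha => hε a ha.1) 5 (by norm_num)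
  have hUcount : U.Countable := hUd.countable_of_isOpen (fun _ _ => isOpen_ball)
    fun a ha => nonempty_ball.2 (hA a (hUB ha).1).pos
  -- disjointness persists at the time `τ'`
  have key : ∀ a ∈ U, ∀ b ∈ U, a ≠ b → ε a ≤ ε b →
      Disjoint (ball (γ a τ') (4⁻¹ * ε a)) (ball (γ b τ') (4⁻¹ * ε b)) := by
    intro a ha b hb hab hle
    have hta := hA a (hUB ha).1
    have htb := hA b (hUB hb).1
    have hpa := hta.pos
    have hpb := htb.pos
    rw [Set.disjoint_left]
    intro y hya hyb
    rw [mem_ball, dist_eq_norm] at hya hyb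
    -- If the quarter balls met at `τ'`, the centers would be within `ε b / 2 + ε b / 4 < ε b` at
    -- `τ`, against disjointness of the full balls there.
    have hD : ‖γ a τ' - γ b τ'‖ < ε b / 2 := by
      have h1 := norm_sub_le_norm_sub_add_norm_sub (γ a τ') y (γ b τ')
      rw [norm_sub_rev (γ a τ') y] at h1
      linarith
    have hJ : ∀ c ∈ U, Ioo (min τ' τ) (max τ' τ) ⊆ lifespan (ε c) (t c) := fun c hc =>
      Ioo_subset_Icc_self.trans
        (ordConnected_Ioo.uIcc_subset (hτ'mem c (hUB hc)).1 (hUB hc).2)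
    have h2 := IsTameCurve.norm_sub_sub_lt hI hV hθ hta htb (by linarith)
      (hta.Ioo_subset (hτ'mem a (hUB ha)).1) (hta.Ioo_subset (hUB ha).2) (hJ a ha) (hJ b hb)
      (by linarith)
    have h3 := norm_add_le ((γ a τ - γ b τ) - (γ a τ' - γ b τ')) (γ a τ' - γ b τ')
    rw [sub_add_cancel] at h3
    refine (Set.disjoint_left.1 (hUd ha hb hab)) (mem_ball_self hpa) ?_
    rw [mem_ball, dist_eq_norm]
    linarith
  have hdisj : U.PairwiseDisjoint fun a => ball (γ a τ') (4⁻¹ * ε a) := by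
    intro a ha b hb hab
    rcases le_total (ε a) (ε b) with h | h
    · exact key a ha b hb hab h
    · exact (key b hb a ha hab.symm h).symm
  calc volume (⋃ a ∈ B, ball (γ a τ) (ε a))
      ≤ volume (⋃ a ∈ U, ball (γ a τ) (5 * ε a)) := by
        refine measure_mono (iUnion₂_subset fun a ha => ?_)
        obtain ⟨b, hb, hab⟩ := hUc a ha
        exact hab.trans (subset_biUnion_of_mem (u := fun a => ball (γ a τ) (5 * ε a)) hb)
    _ ≤ ∑' a : U, volume (ball (γ a τ) (5 * ε a)) := measure_biUnion_le _ hUcount _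
    -- The factor `20` is the Vitali enlargement `5` over the shrinking `1 / 4`.
    _ = ∑' a : U, ENNReal.ofReal (20 ^ d) * volume (ball (γ a τ') (4⁻¹ * ε a)) := by
        refine tsum_congr fun a => ?_
        have hpa := (hA a (hUB a.2).1).pos
        rw [← volume_ball_mul (x := γ a τ) (by norm_num) (by positivity)]
        congr 2
        ring
    _ = ENNReal.ofReal (20 ^ d) * volume (⋃ a ∈ U, ball (γ a τ') (4⁻¹ * ε a)) := by
        rw [ENNReal.tsum_mul_left, measure_biUnion hUcount hdisj fun _ _ => measurableSet_ball]
    _ ≤ ENNReal.ofReal (20 ^ d) * volume (ball (γ₀ τ') (5 * ε₀)) := by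
        gcongr
        refine iUnion₂_subset fun a ha => ball_subset_ball' ?_
        rw [dist_eq_norm]
        linarith [(hτ'mem a (hUB ha)).2, hε a (hUB ha).1]
    _ = ENNReal.ofReal (100 ^ d) * volume (ball (0 : Space d) ε₀) := by
        rw [volume_ball_mul (y := 0) (by norm_num) hε₀, ← mul_assoc,
          ← ENNReal.ofReal_mul (by positivity), ← mul_pow]
        norm_num

/-- The tubes of scale at most `2 ε` that meet a given tube of scale `ε` cover a set of
measure comparable to that of the given tube. -/
lemma IsTameCurve.volume_biUnion_tube_le (hI : I.OrdConnected) (hV : ControlsIncrements I V m C)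
    (hθ : 100 * C * θ ≤ 1) {ι : Type*} {ε t : ι → ℝ} {γ : ι → ℝ → Space d} {A : Set ι}
    (hA : ∀ a ∈ A, IsTameCurve I V m θ (ε a) (t a) (γ a)) {ε₀ t₀ : ℝ} {γ₀ : ℝ → Space d}
    (h₀ : IsTameCurve I V m θ ε₀ t₀ γ₀) (hε : ∀ a ∈ A, ε a ≤ 2 * ε₀)
    (hne : ∀ a ∈ A, (tube (lifespan (ε a) (t a)) (γ a) (ε a) ∩
      tube (lifespan ε₀ t₀) γ₀ ε₀).Nonempty) :
    volume (⋃ a ∈ A, tube (lifespan (ε a) (t a)) (γ a) (ε a)) ≤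
      ENNReal.ofReal (9 * 100 ^ d) * volume (tube (lifespan ε₀ t₀) γ₀ ε₀) := by
  have hε₀ := h₀.pos
  set N := ⋃ a ∈ A, tube (lifespan (ε a) (t a)) (γ a) (ε a) with hN
  have hNo : IsOpen N := isOpen_biUnion fun a ha => (hA a ha).isOpen_tube _
  have hslice : ∀ τ, Prod.mk τ ⁻¹' N =
      ⋃ a ∈ {a ∈ A | τ ∈ lifespan (ε a) (t a)}, ball (γ a τ) (ε a) := by
    intro τ
    ext y
    simp only [hN, mem_preimage, mem_iUnion, mk_mem_tube, exists_prop, Set.mem_ofPred_eq]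
    exact exists_congr fun a => by tauto
  -- A lifespan meeting the reference one has length at most `8 ε₀ ^ 2`, so it reaches at most `9 ε₀
  -- ^ 2` from `t₀`.
  have hout : ∀ τ ∉ Ioo (t₀ - 9 * ε₀ ^ 2) (t₀ + 9 * ε₀ ^ 2), volume (Prod.mk τ ⁻¹' N) = 0 := by
    intro τ hτ
    have : Prod.mk τ ⁻¹' N = ∅ := by
      rw [eq_empty_iff_forall_notMem]
      intro y hy
      rw [hslice] at hy
      obtain ⟨a, ⟨ha, hτa⟩, -⟩ := mem_iUnion₂.1 hy
      obtain ⟨⟨σ, z⟩, ⟨hσ, -⟩, ⟨hσ₀, -⟩⟩ := hne a ha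
      dsimp only at hσ hσ₀
      have hsq : ε a ^ 2 ≤ 4 * ε₀ ^ 2 := by
        have h1 := pow_le_pow_left₀ (hA a ha).pos.le (hε a ha) 2
        linarith [mul_pow 2 ε₀ 2]
      exact hτ ⟨by linarith [hσ.1, hσ.2, hσ₀.1, hσ₀.2, hτa.1, hτa.2],
        by linarith [hσ.1, hσ.2, hσ₀.1, hσ₀.2, hτa.1, hτa.2]⟩
    rw [this, measure_empty]
  rw [Measure.volume_eq_prod, Measure.prod_apply hNo.measurableSet, ← Measure.volume_eq_prod]
  calc ∫⁻ τ, volume (Prod.mk τ ⁻¹' N)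
      ≤ ∫⁻ τ, (Ioo (t₀ - 9 * ε₀ ^ 2) (t₀ + 9 * ε₀ ^ 2)).indicator
          (fun _ => ENNReal.ofReal (100 ^ d) * volume (ball (0 : Space d) ε₀)) τ := by
        refine lintegral_mono fun τ => ?_
        by_cases hτ : τ ∈ Ioo (t₀ - 9 * ε₀ ^ 2) (t₀ + 9 * ε₀ ^ 2)
        · rw [indicator_of_mem hτ, hslice]
          exact volume_iUnion_slice_le hI hV hθ hA h₀ hε hne τ
        · rw [hout τ hτ]
          exact zero_le
    _ = ENNReal.ofReal (100 ^ d) * volume (ball (0 : Space d) ε₀) *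
          ENNReal.ofReal (18 * ε₀ ^ 2) := by
        rw [lintegral_indicator measurableSet_Ioo, setLIntegral_const, Real.volume_Ioo]
        ring_nf
    _ = _ := by
        rw [h₀.volume_tube, show 18 * ε₀ ^ 2 = 9 * (2 * ε₀ ^ 2) by ring,
          ENNReal.ofReal_mul (by positivity : (0 : ℝ) ≤ 9),
          ENNReal.ofReal_mul (by positivity : (0 : ℝ) ≤ 9)]
        ring

/-- A weak type estimate for the union of tame tubes on which the mean of `h` is large. -/
lemma IsTameCurve.volume_biUnion_le_lintegral (hI : I.OrdConnected)
    (hV : ControlsIncrements I V m C) (hθ : 100 * C * θ ≤ 1) {ι : Type*} {ε t : ι → ℝ}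
    {γ : ι → ℝ → Space d} {A : Set ι} (hA : ∀ a ∈ A, IsTameCurve I V m θ (ε a) (t a) (γ a))
    {h : ℝ × Space d → ℝ≥0∞} {r : ℝ≥0∞} (hr : r ≠ 0) (hr' : r ≠ ∞)
    (hfin : ∫⁻ w in I ×ˢ univ, h w ≠ ∞)
    (hmean : ∀ a ∈ A, r * volume (tube (lifespan (ε a) (t a)) (γ a) (ε a)) ≤
      ∫⁻ w in tube (lifespan (ε a) (t a)) (γ a) (ε a), h w) :
    volume (⋃ a ∈ A, tube (lifespan (ε a) (t a)) (γ a) (ε a)) ≤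
      ENNReal.ofReal (9 * 100 ^ d) * (r⁻¹ * ∫⁻ w in I ×ˢ univ, h w) := by
  set Q : ι → Set (ℝ × Space d) := fun a => tube (lifespan (ε a) (t a)) (γ a) (ε a) with hQ
  set F := ∫⁻ w in I ×ˢ univ, h w with hF
  have hQI : ∀ a ∈ A, Q a ⊆ I ×ˢ univ := fun a ha w hw =>
    ⟨(hA a ha).Ioo_subset hw.1, mem_univ _⟩
  have hQF : ∀ a ∈ A, volume (Q a) ≤ r⁻¹ * F := by
    intro a ha
    have h1 := (hmean a ha).trans (lintegral_mono_set (hQI a ha))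
    rwa [mul_comm, ← ENNReal.le_div_iff_mul_le (Or.inl hr) (Or.inl hr'),
      ENNReal.div_eq_inv_mul] at h1
  have hc : r⁻¹ * F ≠ ∞ := ENNReal.mul_ne_top (ENNReal.inv_ne_top.2 hr) hfin
  have hω : 0 < volume (ball (0 : Space d) 1) := measure_ball_pos _ _ one_pos
  -- Vitali selection needs bounded radii. A large mean and a finite integral bound the tube volume,
  -- and that volume dominates a multiple of `ε a` once `ε a ≥ 1`.
  have hbdd : ∀ a ∈ A, ε a ≤ max 1 ((volume (ball (0 : Space d) 1))⁻¹ * (r⁻¹ * F)).toReal := by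
    intro a ha
    have hpa := (hA a ha).pos
    rcases le_total (ε a) 1 with h1 | h1
    · exact h1.trans (le_max_left _ _)
    · refine le_max_of_le_right ?_
      have h2 := hQF a ha
      rw [hQ, (hA a ha).volume_tube, volume_ball_eq 0 hpa] at h2
      have hfin' : (volume (ball (0 : Space d) 1))⁻¹ * (r⁻¹ * F) ≠ ∞ :=
        ENNReal.mul_ne_top (ENNReal.inv_ne_top.2 hω.ne') hc
      rw [← ENNReal.ofReal_le_iff_le_toReal hfin']
      calc ENNReal.ofReal (ε a) ≤ ENNReal.ofReal (ε a ^ d) * ENNReal.ofReal (2 * ε a ^ 2) := by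
            rw [← ENNReal.ofReal_mul (by positivity)]
            refine ENNReal.ofReal_le_ofReal ?_
            have h3 : 1 ≤ ε a ^ d := one_le_pow₀ h1
            nlinarith
        _ = (volume (ball (0 : Space d) 1))⁻¹ * (ENNReal.ofReal (ε a ^ d) *
              volume (ball (0 : Space d) 1) * ENNReal.ofReal (2 * ε a ^ 2)) := by
            rw [mul_comm _ (volume (ball (0 : Space d) 1)), mul_assoc, ← mul_assoc,
              ENNReal.inv_mul_cancel hω.ne' measure_ball_lt_top.ne, one_mul]
        _ ≤ _ := by gcongr
  obtain ⟨U, hUA, hUd, hUc⟩ := Vitali.exists_disjoint_subfamily_covering_enlargement Q A ε 2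
    one_lt_two (fun a ha => (hA a ha).pos.le) _ hbdd (fun a ha =>
      ⟨(t a, γ a (t a)), by
        have := (hA a ha).pos
        exact ⟨⟨by simp [pow_pos this], by simp [pow_pos this]⟩, by simpa using this⟩⟩)
  have hUo : ∀ a ∈ U, IsOpen (Q a) := fun a ha => (hA a (hUA ha)).isOpen_tube _
  have hUcount : U.Countable := hUd.countable_of_isOpen hUo (fun a ha =>
      ⟨(t a, γ a (t a)), by
        have := (hA a (hUA ha)).pos
        exact ⟨⟨by simp [pow_pos this], by simp [pow_pos this]⟩, by simpa using this⟩⟩)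
  calc volume (⋃ a ∈ A, Q a)
      ≤ volume (⋃ b ∈ U, ⋃ a ∈ {a ∈ A | (Q a ∩ Q b).Nonempty ∧ ε a ≤ 2 * ε b}, Q a) := by
        refine measure_mono (iUnion₂_subset fun a ha => ?_)
        obtain ⟨b, hb, hab⟩ := hUc a ha
        exact (subset_biUnion_of_mem (u := Q) (show a ∈ {a ∈ A | (Q a ∩ Q b).Nonempty ∧
          ε a ≤ 2 * ε b} from ⟨ha, hab⟩)).trans (subset_biUnion_of_mem
            (u := fun b => ⋃ a ∈ {a ∈ A | (Q a ∩ Q b).Nonempty ∧ ε a ≤ 2 * ε b}, Q a) hb)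
    _ ≤ ∑' b : U, volume (⋃ a ∈ {a ∈ A | (Q a ∩ Q b).Nonempty ∧ ε a ≤ 2 * ε b}, Q a) :=
        measure_biUnion_le _ hUcount _
    _ ≤ ∑' b : U, ENNReal.ofReal (9 * 100 ^ d) * (r⁻¹ * ∫⁻ w in Q b, h w) := by
        refine ENNReal.tsum_le_tsum fun b => ?_
        refine (volume_biUnion_tube_le hI hV hθ (fun a ha => hA a ha.1) (hA b (hUA b.2))
          (fun a ha => ha.2.2) fun a ha => ha.2.1).trans ?_
        gcongr
        have h1 := hmean b (hUA b.2)
        rwa [mul_comm, ← ENNReal.le_div_iff_mul_le (Or.inl hr) (Or.inl hr'),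
          ENNReal.div_eq_inv_mul] at h1
    _ = ENNReal.ofReal (9 * 100 ^ d) * (r⁻¹ * ∫⁻ w in ⋃ b ∈ U, Q b, h w) := by
        rw [lintegral_biUnion hUcount (fun b hb => (hUo b hb).measurableSet) hUd,
          ENNReal.tsum_mul_left, ENNReal.tsum_mul_left]
    _ ≤ _ := by
        gcongr
        exact lintegral_mono_set (iUnion₂_subset fun b hb => hQI b (hUA hb))

end Covering

/-! ### Continuity of tube integrals in the center -/

section Stability

variable {d : ℕ} {I : Set ℝ} {V : ℝ → ℝ → Space d → Space d} {m : ℝ → Space d → ℝ≥0∞} {C θ : ℝ≥0}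

/-- The lateral boundary of a tube has spheres as slices and is null. Indicators of converging tubes
may fail to converge only there. -/
lemma ae_norm_sub_ne {J : Set ℝ} {γ : ℝ → Space d} (hJ : IsOpen J) (hγ : ContinuousOn γ J)
    {r : ℝ} (hr : r ≠ 0) : ∀ᵐ w : ℝ × Space d, w.1 ∈ J → ‖w.2 - γ w.1‖ ≠ r := by
  have h1 : ContinuousOn (fun w : ℝ × Space d => ‖w.2 - γ w.1‖) (J ×ˢ univ) :=
    (continuousOn_snd.sub (hγ.comp continuousOn_fst fun w hw => hw.1)).norm
  have hJu : IsOpen (J ×ˢ (univ : Set (Space d))) := hJ.prod isOpen_univ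
  have hm : MeasurableSet {w : ℝ × Space d | ¬(w.1 ∈ J → ‖w.2 - γ w.1‖ ≠ r)} := by
    have h2 := h1.isOpen_inter_preimage hJu (isOpen_compl_singleton (x := r))
    convert! hJu.measurableSet.diff h2.measurableSet using 1
    ext w
    simp
  refine (Measure.measure_prod_null hm).2 (ae_of_all _ fun s => ?_)
  refine measure_mono_null (fun y hy => ?_) (Measure.addHaar_sphere_of_ne_zero volume (γ s) hr)
  have hy' : ¬(s ∈ J → ‖y - γ s‖ ≠ r) := hy
  rw [mem_sphere, dist_eq_norm]
  tauto

/-- The radius of the largest lifespan around `t'` inside the lifespan of radius `ε` around `t`. -/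
noncomputable def shrunkRadius (ε t t' : ℝ) : ℝ := √(ε ^ 2 - |t' - t|)

lemma lifespan_shrunkRadius_subset {ε t t' : ℝ} (h : |t' - t| ≤ ε ^ 2) :
    lifespan (shrunkRadius ε t t') t' ⊆ lifespan ε t := by
  rw [lifespan, lifespan, shrunkRadius, Real.sq_sqrt (by linarith)]
  refine Ioo_subset_Ioo ?_ ?_
  · linarith [neg_abs_le (t' - t)]
  · linarith [le_abs_self (t' - t)]

lemma shrunkRadius_le {ε : ℝ} (hε : 0 ≤ ε) (t t' : ℝ) : shrunkRadius ε t t' ≤ ε :=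
  Real.sqrt_le_iff.2 ⟨hε, by linarith [abs_nonneg (t' - t)]⟩

lemma tendsto_shrunkRadius {ε : ℝ} (hε : 0 ≤ ε) (z : ℝ × Space d) :
    Tendsto (fun z' : ℝ × Space d => shrunkRadius ε z.1 z'.1) (𝓝 z) (𝓝 ε) := by
  have h : Continuous fun z' : ℝ × Space d => shrunkRadius ε z.1 z'.1 := by
    unfold shrunkRadius; fun_prop
  have h2 := h.tendsto z
  simpa [shrunkRadius, Real.sqrt_sq hε] using h2

/-- Integrals over tubes around a family of integral curves are continuous at a tame curve, for
the shrunk radii. -/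
lemma IsTameCurve.tendsto_lintegral_tube (hIo : IsOpen I) (hI : I.OrdConnected)
    (hV : ControlsIncrements I V m C)
    (hθ : 100 * C * θ ≤ 1) {X : ℝ → ℝ × Space d → ℝ → Space d}
    (hX : ∀ ε > 0, ∀ z : ℝ × Space d, z.1 ∈ I →
      IsIntegratedCurve I (V ε) (X ε z) ∧ X ε z z.1 = z.2)
    {ε : ℝ} {z : ℝ × Space d} (hz : IsTameCurve I V m θ ε z.1 (X ε z))
    {h : ℝ × Space d → ℝ≥0∞} (hh : AEMeasurable h (volume.restrict (I ×ˢ univ)))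
    (hfin : ∀ E ⊆ I ×ˢ univ, volume E < ∞ → ∫⁻ w in E, h w < ∞) :
    Tendsto (fun z' => ∫⁻ w in tube (lifespan (shrunkRadius ε z.1 z'.1) z'.1)
        (X (shrunkRadius ε z.1 z'.1) z') (shrunkRadius ε z.1 z'.1), h w) (𝓝 z)
      (𝓝 (∫⁻ w in tube (lifespan ε z.1) (X ε z) ε, h w)) := by
  have hε := hz.pos
  set e : ℝ × Space d → ℝ := fun z' => shrunkRadius ε z.1 z'.1 with he
  set Y : ℝ × Space d → ℝ → Space d := fun z' => X (e z') z' with hY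
  have hzself : z.1 ∈ lifespan ε z.1 := ⟨by linarith [pow_pos hε 2], by linarith [pow_pos hε 2]⟩
  have het : Tendsto e (𝓝 z) (𝓝 ε) := tendsto_shrunkRadius hε.le z
  have hle : ∀ z', e z' ≤ ε := fun z' => shrunkRadius_le hε.le _ _
  have hhalf : ∀ᶠ z' in 𝓝 z, ε / 2 < e z' := het.eventually (lt_mem_nhds (by linarith))
  have hmemI : ∀ᶠ z' in 𝓝 z, z'.1 ∈ lifespan ε z.1 :=
    continuous_fst.continuousAt.eventually (isOpen_Ioo.mem_nhds hzself)
  have hlife : ∀ᶠ z' in 𝓝 z, lifespan (e z') z'.1 ⊆ lifespan ε z.1 := by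
    filter_upwards [hmemI] with z' hz'
    exact lifespan_shrunkRadius_subset
      (abs_le.2 ⟨by linarith [hz'.1], by linarith [hz'.2]⟩)
  -- Center curves converge uniformly on the shrunk lifespans, which stay inside the lifespan where
  -- the curve at `z` is tame.
  have hclose : ∀ κ, 0 < κ → 2 * κ ≤ ε → ∀ᶠ z' in 𝓝 z, ∀ s ∈ lifespan (e z') z'.1,
      ‖Y z' s - X ε z s‖ < 2 * κ := by
    intro κ hκ hκε
    have hlim : Tendsto (fun z' : ℝ × Space d => ‖z'.2 - X ε z z'.1‖ + |e z' - ε|) (𝓝 z)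
        (𝓝 (‖z.2 - X ε z z.1‖ + |ε - ε|)) := by
      have h1 : Tendsto (fun z' : ℝ × Space d => X ε z z'.1) (𝓝 z) (𝓝 (X ε z z.1)) :=
        ((hz.continuousOn.continuousAt (hIo.mem_nhds hz.mem)).tendsto.comp
          continuous_fst.continuousAt.tendsto)
      exact (((continuous_snd.tendsto z).sub h1).norm).add ((het.sub_const ε).abs)
    rw [(hX ε hε z hz.mem).2, sub_self, sub_self, norm_zero, abs_zero, add_zero] at hlim
    filter_upwards [hlim.eventually (ge_mem_nhds hκ), hhalf, hmemI, hlife] with z' h1 h2 h3 h4 s hs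
    have hpos : 0 < e z' := by linarith
    have hz'I := hz.Ioo_subset h3
    obtain ⟨hcurve, hself⟩ := hX (e z') hpos z' hz'I
    have hself' : z'.1 ∈ lifespan (e z') z'.1 :=
      ⟨by linarith [pow_pos hpos 2], by linarith [pow_pos hpos 2]⟩
    refine hz.norm_sub_lt hI hV hθ hcurve h2.le (hle z') hz'I (hz.Ioo_subset (h4 hs)) ?_ hκ hκε ?_
    · exact Ioo_subset_Icc_self.trans ((ordConnected_Ioo.uIcc_subset hself' hs).trans h4)
    · rw [hself]
      exact h1
  have hopen : ∀ᶠ z' in 𝓝 z, IsOpen (tube (lifespan (e z') z'.1) (Y z') (e z')) := by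
    filter_upwards [hhalf, hmemI, hlife] with z' h2 h3 h4
    exact SkewedCylinder.isOpen_tube isOpen_Ioo ((hX (e z') (by linarith) z'
      (hz.Ioo_subset h3)).1.continuousOn.mono (h4.trans hz.Ioo_subset)) _
  -- The tube of doubled radius has finite measure and supplies the dominating function.
  have hsub : ∀ᶠ z' in 𝓝 z, tube (lifespan (e z') z'.1) (Y z') (e z') ⊆
      tube (lifespan ε z.1) (X ε z) (2 * ε) := by
    filter_upwards [hlife, hclose (ε / 2) (by linarith) (by linarith)] with z' h1 h2 w hw
    refine ⟨h1 hw.1, ?_⟩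
    have h3 := norm_sub_le_norm_sub_add_norm_sub w.2 (Y z' w.1) (X ε z w.1)
    linarith [h2 w.1 hw.1, hw.2, hle z']
  have hbig : tube (lifespan ε z.1) (X ε z) (2 * ε) ⊆ I ×ˢ univ := fun w hw =>
    ⟨hz.Ioo_subset hw.1, mem_univ _⟩
  have hbigm := (hz.isOpen_tube (2 * ε)).measurableSet
  have hvol : volume (tube (lifespan ε z.1) (X ε z) (2 * ε)) < ∞ := by
    rw [hz.volume_tube]
    exact ENNReal.mul_lt_top measure_ball_lt_top ENNReal.ofReal_lt_top
  rw [← lintegral_indicator (hz.isOpen_tube ε).measurableSet]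
  have hcongr : (fun z' => ∫⁻ w, (tube (lifespan (e z') z'.1) (Y z') (e z')).indicator h w) =ᶠ[𝓝 z]
      fun z' => ∫⁻ w in tube (lifespan (e z') z'.1) (Y z') (e z'), h w := by
    filter_upwards [hopen] with z' hz'
    rw [lintegral_indicator hz'.measurableSet]
  refine Tendsto.congr' hcongr ?_
  refine tendsto_lintegral_filter_of_dominated_convergence'
    ((tube (lifespan ε z.1) (X ε z) (2 * ε)).indicator h) ?_ ?_ ?_ ?_
  · filter_upwards [hopen, hsub] with z' h1 h2
    exact (aemeasurable_indicator_iff h1.measurableSet).2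
      (hh.mono_measure (Measure.restrict_mono (h2.trans hbig) le_rfl))
  · filter_upwards [hsub] with z' h2
    exact ae_of_all _ fun w => indicator_le_indicator_of_subset h2 (fun _ => zero_le) w
  · rw [lintegral_indicator hbigm]
    exact (hfin _ hbig hvol).ne
  -- Off the lateral boundary the indicators are eventually constant; `κ` is chosen from the
  -- distance of `w` to that boundary.
  · filter_upwards [ae_norm_sub_ne isOpen_Ioo (hz.continuousOn.mono hz.Ioo_subset) hε.ne'] with w hw
    refine tendsto_const_nhds.congr' ?_
    by_cases hs : w.1 ∈ lifespan ε z.1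
    · rcases lt_or_gt_of_ne (hw hs) with hlt | hgt
      · set κ := (ε - ‖w.2 - X ε z w.1‖) / 3 with hκ
        have hκ0 : 0 < κ := by rw [hκ]; linarith
        have hκε : 2 * κ ≤ ε := by rw [hκ]; linarith [norm_nonneg (w.2 - X ε z w.1)]
        have htime : ∀ᶠ z' in 𝓝 z, w.1 ∈ lifespan (e z') z'.1 := by
          have h1 : Tendsto (fun z' : ℝ × Space d => z'.1 - e z' ^ 2) (𝓝 z) (𝓝 (z.1 - ε ^ 2)) :=
            (continuous_fst.tendsto z).sub (het.pow 2)
          have h2 : Tendsto (fun z' : ℝ × Space d => z'.1 + e z' ^ 2) (𝓝 z) (𝓝 (z.1 + ε ^ 2)) :=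
            (continuous_fst.tendsto z).add (het.pow 2)
          filter_upwards [h1.eventually (gt_mem_nhds hs.1), h2.eventually (lt_mem_nhds hs.2)]
            with z' h3 h4 using ⟨h3, h4⟩
        filter_upwards [htime, hclose κ hκ0 hκε,
          het.eventually (lt_mem_nhds (show ε - κ < ε by linarith))] with z' h1 h2 h3
        rw [indicator_of_mem (show w ∈ tube (lifespan ε z.1) (X ε z) ε from ⟨hs, hlt⟩),
          indicator_of_mem]
        refine ⟨h1, ?_⟩
        have h4 := norm_sub_le_norm_sub_add_norm_sub w.2 (X ε z w.1) (Y z' w.1)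
        have h5 := h2 w.1 h1
        rw [norm_sub_rev] at h5
        have h6 : 3 * κ = ε - ‖w.2 - X ε z w.1‖ := by rw [hκ]; ring
        linarith
      · set κ := min ((‖w.2 - X ε z w.1‖ - ε) / 2) (ε / 2) with hκ
        have hκ0 : 0 < κ := lt_min (by linarith) (by linarith)
        have hκε : 2 * κ ≤ ε := by linarith [min_le_right ((‖w.2 - X ε z w.1‖ - ε) / 2) (ε / 2)]
        filter_upwards [hclose κ hκ0 hκε] with z' h2
        rw [indicator_of_notMem fun h => hgt.not_gt h.2, indicator_of_notMem]
        rintro ⟨h1, h3⟩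
        have h4 := norm_sub_le_norm_sub_add_norm_sub w.2 (Y z' w.1) (X ε z w.1)
        linarith [h2 w.1 h1, hle z', min_le_left ((‖w.2 - X ε z w.1‖ - ε) / 2) (ε / 2)]
    · filter_upwards [hlife] with z' h1
      rw [indicator_of_notMem fun h => hs h.1, indicator_of_notMem fun h => hs (h1 h.1)]

end Stability

/-! ### Marcinkiewicz interpolation -/

section Interpolation

variable {α : Type*} [MeasurableSpace α] {μ : Measure α}

/-- Where `|f| > r / 2`, one has `|f| ≤ (r / 2) ^ (1 - p) |f| ^ p`. -/
lemma memLp_one_indicator_of_memLp {f : α → ℝ} {p : ℝ≥0∞} (hp : 1 < p) (hpt : p ≠ ∞)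
    (hf : MemLp f p μ) {r : ℝ} (hr : 0 < r) :
    MemLp ({z | r < 2 * ‖f z‖}.indicator f) 1 μ := by
  have hp1 : 1 < p.toReal := by
    rw [← ENNReal.toReal_one]
    exact (ENNReal.toReal_lt_toReal ENNReal.one_ne_top hpt).2 hp
  have hset : NullMeasurableSet {z | r < 2 * ‖f z‖} μ :=
    nullMeasurableSet_lt aemeasurable_const (hf.1.norm.aemeasurable.const_mul 2)
  have hint : Integrable (fun z => (r / 2) ^ (1 - p.toReal) * ‖f z‖ ^ p.toReal) μ :=
    (hf.integrable_norm_rpow (zero_lt_one.trans hp).ne' hpt).const_mul _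
  rw [memLp_one_iff_integrable]
  refine hint.mono' (hf.1.indicator₀ hset) (ae_of_all _ fun z => ?_)
  by_cases hz : r < 2 * ‖f z‖
  · rw [indicator_of_mem (show z ∈ {z | r < 2 * ‖f z‖} from hz)]
    have h1 : r / 2 ≤ ‖f z‖ := by linarith
    have h2 : 0 < ‖f z‖ := by linarith
    calc ‖f z‖ = ‖f z‖ ^ (1 - p.toReal) * ‖f z‖ ^ p.toReal := by
          rw [← Real.rpow_add h2]; simp
      _ ≤ _ := by
          gcongr ?_ * _
          exact Real.rpow_le_rpow_of_nonpos (by linarith) h1 (by linarith)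
  · rw [indicator_of_notMem (show z ∉ {z | r < 2 * ‖f z‖} from hz), norm_zero]
    positivity

/-- The Marcinkiewicz interpolation theorem between weak type `(1, 1)` and strong type `(∞, ∞)`
for a maximal operator. -/
theorem exists_lintegral_rpow_le_of_weak_type (C₁ : ℝ≥0) {p : ℝ} (hp : 1 < p) :
    ∃ C : ℝ≥0, ∀ (μ : Measure α) (M : (α → ℝ) → α → ℝ≥0∞),
      (∀ f : α → ℝ, MemLp f 1 μ → ∀ r : ℝ, 0 < r →
        μ {z | ENNReal.ofReal r < M f z} ≤ C₁ / ENNReal.ofReal r * eLpNorm f 1 μ) →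
      (∀ (f : α → ℝ) (r : ℝ), 0 < r → ∀ᵐ z ∂μ,
        M f z ≤ M ({z | r < 2 * ‖f z‖}.indicator f) z + ENNReal.ofReal (r / 2)) →
      ∀ f : α → ℝ, MemLp f (ENNReal.ofReal p) μ → AEMeasurable (M f) μ →
        ∫⁻ z, M f z ^ p ∂μ ≤ C * ∫⁻ z, ‖f z‖ₑ ^ p ∂μ := by
  have hp0 : 0 < p := zero_lt_one.trans hp
  have hp1 : 0 < p - 1 := sub_pos.2 hp
  have hCfin : ENNReal.ofReal p * (2 * C₁) * (ENNReal.ofReal (p - 1))⁻¹ *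
      ENNReal.ofReal (2 ^ (p - 1)) ≠ ∞ := by
    have : (ENNReal.ofReal (p - 1))⁻¹ ≠ ∞ := ENNReal.inv_ne_top.2 (by simpa using hp)
    finiteness
  refine ⟨(ENNReal.ofReal p * (2 * C₁) * (ENNReal.ofReal (p - 1))⁻¹ *
    ENNReal.ofReal (2 ^ (p - 1))).toNNReal, fun μ M hweak hsub f hf hM => ?_⟩
  rw [ENNReal.coe_toNNReal hCfin]
  -- The `L^1` norm of `f` truncated from below is a distribution function with respect to `ν`, so a
  -- second layer cake formula replaces an exchange of integrals.
  set ν := μ.withDensity fun z => ‖f z‖ₑ with hν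
  have hmeas : ∀ r : ℝ, NullMeasurableSet {z | r < 2 * ‖f z‖} μ := fun r =>
    nullMeasurableSet_lt aemeasurable_const (hf.1.norm.aemeasurable.const_mul 2)
  have hnorm : ∀ r : ℝ, eLpNorm ({z | r < 2 * ‖f z‖}.indicator f) 1 μ = ν {z | r < 2 * ‖f z‖} := by
    intro r
    rw [hν, withDensity_apply₀ _ (hmeas r), eLpNorm_one_eq_lintegral_enorm,
      ← lintegral_indicator₀ (hmeas r)]
    simp_rw [enorm_indicator_eq_indicator_enorm]
  have hpE : 1 < ENNReal.ofReal p := by simpa using hp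
  have hdist : ∀ r : ℝ, 0 < r → μ {z | ENNReal.ofReal r < M f z} ≤
      2 * C₁ / ENNReal.ofReal r * ν {z | r < 2 * ‖f z‖} := by
    intro r hr
    have h1 := hweak _ (memLp_one_indicator_of_memLp hpE ENNReal.ofReal_ne_top hf hr) (r / 2)
      (half_pos hr)
    rw [hnorm] at h1
    have h2 : (C₁ : ℝ≥0∞) / ENNReal.ofReal (r / 2) = 2 * C₁ / ENNReal.ofReal r := by
      rw [ENNReal.ofReal_div_of_pos two_pos, ENNReal.ofReal_ofNat, mul_comm,
        ENNReal.div_eq_inv_mul, ENNReal.inv_div (by simp) (by simp), ENNReal.div_eq_inv_mul,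
        ENNReal.div_eq_inv_mul]
      ring
    rw [← h2]
    refine (measure_mono_ae ?_).trans h1
    filter_upwards [hsub f r hr] with z hz hlt
    by_contra! hle
    have hle' : M ({z | r < 2 * ‖f z‖}.indicator f) z ≤ ENNReal.ofReal (r / 2) :=
      not_lt.1 hle
    have hlt' : ENNReal.ofReal r < M f z := hlt
    refine hlt'.not_ge (hz.trans ?_)
    calc _ ≤ ENNReal.ofReal (r / 2) + ENNReal.ofReal (r / 2) := by gcongr
      _ = ENNReal.ofReal r := by
        rw [← ENNReal.ofReal_add (by positivity) (by positivity), add_halves]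
  have hνfin : ν {z | 1 < 2 * ‖f z‖} ≠ ∞ := by
    rw [← hnorm]
    exact (memLp_one_indicator_of_memLp hpE ENNReal.ofReal_ne_top hf one_pos).eLpNorm_ne_top
  -- The layer cake formula is applied to real-valued functions, so `M f` must first be finite
  -- almost everywhere.
  have htop : ∀ᵐ z ∂μ, M f z ≠ ∞ := by
    have hlim : Tendsto (fun n : ℕ => (2 * C₁ * ν {z | 1 < 2 * ‖f z‖}) / (n : ℝ≥0∞)) atTop
        (𝓝 0) := by
      have := ENNReal.Tendsto.const_div (a := 2 * C₁ * ν {z | 1 < 2 * ‖f z‖})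
        ENNReal.tendsto_nat_nhds_top (Or.inr (by finiteness))
      simpa using this
    refine le_antisymm (ge_of_tendsto hlim ?_) zero_le
    filter_upwards [eventually_ge_atTop 1] with n hn
    have hn' : (1 : ℝ) ≤ n := by exact_mod_cast hn
    calc μ {z | ¬ M f z ≠ ∞} ≤ μ {z | ENNReal.ofReal n < M f z} := by
          refine measure_mono fun z hz => ?_
          have hz' : M f z = ∞ := not_not.1 hz
          show ENNReal.ofReal n < M f z
          rw [hz']
          exact ENNReal.ofReal_lt_top
      _ ≤ 2 * C₁ / ENNReal.ofReal n * ν {z | (n : ℝ) < 2 * ‖f z‖} := hdist n (by linarith)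
      _ ≤ 2 * C₁ / ENNReal.ofReal n * ν {z | 1 < 2 * ‖f z‖} := by
          gcongr
      _ = _ := by rw [ENNReal.ofReal_natCast, ENNReal.div_eq_inv_mul, ENNReal.div_eq_inv_mul, mul_assoc]
  have hlay := lintegral_rpow_eq_lintegral_meas_lt_mul μ (f := fun z => (M f z).toReal)
    (ae_of_all _ fun _ => ENNReal.toReal_nonneg) hM.ennreal_toReal hp0
  have hlayν := lintegral_rpow_eq_lintegral_meas_lt_mul ν (f := fun z => 2 * ‖f z‖)
    (ae_of_all _ fun _ => by positivity)
    ((hf.1.norm.aemeasurable.const_mul 2).mono_ac (withDensity_absolutelyContinuous _ _)) hp1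
  have hν2 : ∫⁻ z, ENNReal.ofReal ((2 * ‖f z‖) ^ (p - 1)) ∂ν =
      ENNReal.ofReal (2 ^ (p - 1)) * ∫⁻ z, ‖f z‖ₑ ^ p ∂μ := by
    rw [hν, lintegral_withDensity_eq_lintegral_mul₀ hf.1.enorm (by
      exact ((hf.1.norm.aemeasurable.const_mul 2).pow_const _).ennreal_ofReal),
      ← lintegral_const_mul' _ _ ENNReal.ofReal_ne_top]
    refine lintegral_congr fun z => ?_
    rw [Pi.mul_apply, Real.mul_rpow two_pos.le (norm_nonneg _),
      ENNReal.ofReal_mul (by positivity), ← ENNReal.ofReal_rpow_of_nonneg (norm_nonneg _) hp1.le,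
      ofReal_norm, mul_left_comm]
    congr 1
    conv_rhs => rw [show p = 1 + (p - 1) by ring,
      ENNReal.rpow_add_of_nonneg _ _ zero_le_one hp1.le, ENNReal.rpow_one]
  calc ∫⁻ z, M f z ^ p ∂μ = ∫⁻ z, ENNReal.ofReal ((M f z).toReal ^ p) ∂μ := by
        refine lintegral_congr_ae ?_
        filter_upwards [htop] with z hz
        rw [← ENNReal.ofReal_rpow_of_nonneg ENNReal.toReal_nonneg hp0.le, ENNReal.ofReal_toReal hz]
    _ = ENNReal.ofReal p * ∫⁻ r in Ioi 0, μ {z | r < (M f z).toReal} *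
          ENNReal.ofReal (r ^ (p - 1)) := hlay
    _ ≤ ENNReal.ofReal p * ∫⁻ r in Ioi 0, (2 * C₁) * (ν {z | r < 2 * ‖f z‖} *
          ENNReal.ofReal (r ^ (p - 1 - 1))) := by
        gcongr ENNReal.ofReal p * ?_
        refine setLIntegral_mono' measurableSet_Ioi fun r hr => ?_
        have hr' : 0 < r := hr
        have h1 : μ {z | r < (M f z).toReal} ≤ μ {z | ENNReal.ofReal r < M f z} := by
          refine measure_mono fun z hz => ?_
          have hz' : r < (M f z).toReal := hz
          exact (ENNReal.ofReal_lt_iff_lt_toReal hr'.le (fun h => by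
            rw [h, ENNReal.toReal_top] at hz'; linarith)).2 hz'
        calc _ ≤ (2 * C₁ / ENNReal.ofReal r * ν {z | r < 2 * ‖f z‖}) *
              ENNReal.ofReal (r ^ (p - 1)) := by
              gcongr
              exact h1.trans (hdist r hr')
          _ = (2 * C₁) * (ν {z | r < 2 * ‖f z‖} *
              ((ENNReal.ofReal r)⁻¹ * ENNReal.ofReal (r ^ (p - 1)))) := by
              rw [ENNReal.div_eq_inv_mul]; ring
          _ = _ := by
              rw [Real.rpow_sub_one hr'.ne' (p - 1), ENNReal.ofReal_div_of_pos hr',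
                ENNReal.div_eq_inv_mul]
    _ = ENNReal.ofReal p * ((2 * C₁) * ((ENNReal.ofReal (p - 1))⁻¹ *
          ∫⁻ z, ENNReal.ofReal ((2 * ‖f z‖) ^ (p - 1)) ∂ν)) := by
        rw [lintegral_const_mul' _ _ (by finiteness), hlayν, ← mul_assoc (ENNReal.ofReal (p - 1))⁻¹,
          ENNReal.inv_mul_cancel (by simpa using hp) ENNReal.ofReal_ne_top, one_mul]
    _ = _ := by rw [hν2]; ring

end Interpolation

/-! ### The maximal function over admissible cylinders -/

section CylinderMaximal

variable {d : ℕ} {S T : EReal} {p : ℝ≥0∞} {φ : Space d → ℝ} {u : ℝ → Space d → Space d}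
  {G : ℝ → Space d → Space d →L[ℝ] Space d} {η : ℝ} {f : ℝ × Space d → ℝ}

lemma laverage_const_le {α : Type*} [MeasurableSpace α] (μ : Measure α) (c : ℝ≥0∞) :
    laverage μ (fun _ => c) ≤ c := by
  rw [laverage_eq, lintegral_const]
  exact ENNReal.div_le_of_le_mul le_rfl

lemma lt_cylinderMaximal_iff {r : ℝ≥0∞} {z : ℝ × Space d} :
    r < cylinderMaximal φ S T u G η f z ↔ ∃ ε, 0 < ε ∧ IsAdmissible φ S T u G η ε z ∧
      r < laverage (volume.restrict (cylinder φ S T u ε z)) fun w => ‖f w‖ₑ := by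
  simp only [cylinderMaximal, lt_iSup_iff, exists_prop]

lemma IsAdmissible.cylinder_subset {ε : ℝ} {z : ℝ × Space d}
    (h : IsAdmissible φ S T u G η ε z) : cylinder φ S T u ε z ⊆ slab d S T := by
  rw [cylinder_eq_tube]
  exact fun w hw => ⟨h.1 hw.1, mem_univ _⟩

lemma cylinderMaximal_le_eLpNorm_top (z : ℝ × Space d) :
    cylinderMaximal φ S T u G η f z ≤ eLpNorm f ∞ (volume.restrict (slab d S T)) := by
  refine iSup₂_le fun ε hε => iSup_le fun hadm => ?_
  have hac : volume.restrict (cylinder φ S T u ε z) ≤ volume.restrict (slab d S T) :=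
    Measure.restrict_mono hadm.cylinder_subset le_rfl
  have hae : ∀ᵐ w ∂(volume.restrict (cylinder φ S T u ε z)),
      ‖f w‖ₑ ≤ eLpNorm f ∞ (volume.restrict (slab d S T)) := by
    rw [eLpNorm_exponent_top]
    exact ae_mono hac (ae_le_eLpNormEssSup)
  calc _ ≤ laverage (volume.restrict (cylinder φ S T u ε z))
        fun _ => eLpNorm f ∞ (volume.restrict (slab d S T)) := by
        rw [laverage_eq, laverage_eq]
        gcongr ?_ / _
        exact lintegral_mono_ae hae
    _ ≤ _ := laverage_const_le _ _

lemma eLpNorm_top_cylinderMaximal_le :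
    eLpNorm (cylinderMaximal φ S T u G η f) ∞ (volume.restrict (slab d S T)) ≤
      eLpNorm f ∞ (volume.restrict (slab d S T)) := by
  rw [eLpNorm_exponent_top]
  exact eLpNormEssSup_le_of_ae_enorm_bound (ae_of_all _ cylinderMaximal_le_eLpNorm_top)

/-- The part of `f` with `|f| ≤ r / 2` contributes at most `r / 2` to any average. -/
lemma cylinderMaximal_le_indicator_add (r : ℝ) (z : ℝ × Space d) :
    cylinderMaximal φ S T u G η f z ≤
      cylinderMaximal φ S T u G η ({w | r < 2 * ‖f w‖}.indicator f) z + ENNReal.ofReal (r / 2) := by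
  refine iSup₂_le fun ε hε => iSup_le fun hadm => ?_
  have h1 : laverage (volume.restrict (cylinder φ S T u ε z)) (fun w => ‖f w‖ₑ) ≤
      laverage (volume.restrict (cylinder φ S T u ε z))
        (fun w => ‖({w | r < 2 * ‖f w‖}.indicator f) w‖ₑ) +
      laverage (volume.restrict (cylinder φ S T u ε z)) (fun _ => ENNReal.ofReal (r / 2)) := by
    rw [laverage, laverage, laverage, ← lintegral_add_right _ measurable_const]
    refine lintegral_mono fun w => ?_
    by_cases hw : r < 2 * ‖f w‖
    · rw [indicator_of_mem (show w ∈ {w | r < 2 * ‖f w‖} from hw)]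
      exact le_self_add
    · refine le_trans ?_ le_add_self
      rw [← ofReal_norm]
      exact ENNReal.ofReal_le_ofReal (by linarith)
  refine h1.trans (add_le_add ?_ (laverage_const_le _ _))
  exact le_iSup₂_of_le ε hε (le_iSup_of_le hadm le_rfl)

/-- The constant precedes `S`, `T` and `u`; this is what lets the threshold for `η` depend only on
`φ` and `d`. -/
lemma MemL1LocHomSobolev.exists_controlsIncrements (hφ : IsMollifier φ) :
    ∃ C : ℝ≥0, ∀ (S T : EReal) (p : ℝ≥0∞) (u : ℝ → Space d → Space d)
      (G : ℝ → Space d → Space d →L[ℝ] Space d), MemL1LocHomSobolev S T p u G →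
      ControlsIncrements (timeInterval S T) (mollifiedVelocity φ u)
        (fun s => spatialMaximal (G s)) C := by
  obtain ⟨C, hC⟩ := hφ.exists_mollification_sub_le
  refine ⟨C, fun S T p u G hu => ?_⟩
  filter_upwards [hu.isWeakGradient] with τ hτ
  exact hC (u τ) (G τ) hτ

lemma MemL1LocHomSobolev.isIntegratedCurve_mollifiedFlow (hu : MemL1LocHomSobolev S T p u G)
    (hp : 1 ≤ p) (hφ : IsMollifier φ) {ε : ℝ} (hε : 0 < ε) {z : ℝ × Space d}
    (hz : z.1 ∈ timeInterval S T) :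
    IsIntegratedCurve (timeInterval S T) (mollifiedVelocity φ u ε)
        (mollifiedFlow φ S T u ε z.1 z.2) ∧ mollifiedFlow φ S T u ε z.1 z.2 z.1 = z.2 :=
  have h := hu.isMollifiedTrajectory_mollifiedFlow hp hφ hε hz z.2
  ⟨h.isIntegratedCurve hz, h.apply_self hz⟩

/-- The flow line at the center of an admissible cylinder is tame. -/
lemma MemL1LocHomSobolev.isTameCurve_mollifiedFlow (hu : MemL1LocHomSobolev S T p u G)
    (hp : 1 ≤ p) (hφ : IsMollifier φ) {ε : ℝ} (hε : 0 < ε) {z : ℝ × Space d}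
    (hz : z.1 ∈ timeInterval S T) (hadm : IsAdmissible φ S T u G η ε z) :
    IsTameCurve (timeInterval S T) (mollifiedVelocity φ u) (fun s => spatialMaximal (G s))
      (2 * η).toNNReal ε z.1 (mollifiedFlow φ S T u ε z.1 z.2) := by
  set X := mollifiedFlow φ S T u ε z.1 z.2 with hX
  have hcurve := (hu.isIntegratedCurve_mollifiedFlow hp hφ hε hz).1
  have hcont : ContinuousOn X (lifespan ε z.1) := hcurve.continuousOn.mono hadm.1
  have hm : AEMeasurable (fun w : ℝ × Space d => spatialMaximal (G w.1) w.2)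
      (volume.restrict (tube (lifespan ε z.1) X ε)) := by
    refine (aemeasurable_spatialMaximal hu.aestronglyMeasurable_grad).mono_measure
      (Measure.restrict_mono ?_ le_rfl)
    exact fun w hw => ⟨hadm.1 hw.1, mem_univ _⟩
  refine ⟨hcurve, hε, hz, hadm.1, ?_, ?_⟩
  · exact (aemeasurable_lintegral_ball isOpen_Ioo hcont ε hm).const_mul _
  · have hB : volume (ball (0 : Space d) ε) ≠ 0 := (measure_ball_pos _ _ hε).ne'
    have hB' : volume (ball (0 : Space d) ε) ≠ ∞ := measure_ball_lt_top.ne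
    have h1 := hadm.2.le
    rw [cylinder_eq_tube, setLAverage_eq, volume_tube isOpen_Ioo hcont, Real.volume_Ioo,
      show z.1 + ε ^ 2 - (z.1 - ε ^ 2) = 2 * ε ^ 2 by ring, ENNReal.ofReal_mul two_pos.le] at h1
    simp_rw [ballMean]
    rw [lintegral_const_mul' _ _ (ENNReal.inv_ne_top.2 hB),
      ← lintegral_tube isOpen_Ioo hcont ε hm]
    set F := ∫⁻ w in tube (lifespan ε z.1) X ε, spatialMaximal (G w.1) w.2
    set B := volume (ball (0 : Space d) ε)
    have he : ENNReal.ofReal (ε ^ 2) ≠ 0 := by simpa using hε.ne'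
    have he' : ENNReal.ofReal (ε ^ 2) ≠ ∞ := ENNReal.ofReal_ne_top
    -- The tube has measure `2 ε ^ 2 |B_ε|`, so `ε ^ 2` times the mean is half the time integral of
    -- the ball means; hence the bound `2 η`.
    have h2 : ENNReal.ofReal 2 * (ENNReal.ofReal (ε ^ 2) *
        (F / (B * (ENNReal.ofReal 2 * ENNReal.ofReal (ε ^ 2))))) = B⁻¹ * F := by
      rw [ENNReal.div_eq_inv_mul, ENNReal.mul_inv (Or.inl hB) (Or.inl hB'),
        ENNReal.mul_inv (by simp) (by simp)]
      calc _ = (ENNReal.ofReal 2 * (ENNReal.ofReal 2)⁻¹) *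
            (ENNReal.ofReal (ε ^ 2) * (ENNReal.ofReal (ε ^ 2))⁻¹) * (B⁻¹ * F) := by ring
        _ = _ := by
          rw [ENNReal.mul_inv_cancel he he', ENNReal.mul_inv_cancel (by simp) (by simp)]
          simp
    rw [← h2]
    calc _ ≤ ENNReal.ofReal 2 * ENNReal.ofReal η := by gcongr
      _ = _ := by rw [← ENNReal.ofReal_mul two_pos.le]; rfl

lemma IsTameCurve.volume_tube_ne {I : Set ℝ} {V : ℝ → ℝ → Space d → Space d}
    {m : ℝ → Space d → ℝ≥0∞} {θ : ℝ≥0} {ε t : ℝ} {γ : ℝ → Space d}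
    (h : IsTameCurve I V m θ ε t γ) : volume (tube (lifespan ε t) γ ε) ≠ 0 ∧
      volume (tube (lifespan ε t) γ ε) ≠ ∞ := by
  have hε := h.pos
  rw [h.volume_tube]
  refine ⟨mul_ne_zero (measure_ball_pos _ _ hε).ne' ?_,
    ENNReal.mul_ne_top measure_ball_lt_top.ne ENNReal.ofReal_ne_top⟩
  simpa using hε.ne'

/-- The weak type `(1, 1)` estimate. -/
theorem MemL1LocHomSobolev.volume_cylinderMaximal_gt_le (hu : MemL1LocHomSobolev S T p u G)
    (hp : 1 ≤ p) (hφ : IsMollifier φ) {C : ℝ≥0}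
    (hC : ControlsIncrements (timeInterval S T) (mollifiedVelocity φ u)
      (fun s => spatialMaximal (G s)) C)
    (hη : 100 * C * (2 * η).toNNReal ≤ 1) (hf : MemLp f 1 (volume.restrict (slab d S T)))
    {r : ℝ} (hr : 0 < r) :
    volume {z ∈ slab d S T | ENNReal.ofReal r < cylinderMaximal φ S T u G η f z} ≤
      ((9 * 100 ^ d : ℝ≥0) : ℝ≥0∞) / ENNReal.ofReal r *
        eLpNorm f 1 (volume.restrict (slab d S T)) := by
  set A : Set (ℝ × (ℝ × Space d)) := {a | 0 < a.1 ∧ a.2 ∈ slab d S T ∧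
    IsAdmissible φ S T u G η a.1 a.2 ∧
    ENNReal.ofReal r < laverage (volume.restrict (cylinder φ S T u a.1 a.2)) fun w => ‖f w‖ₑ}
    with hA
  have htame : ∀ a ∈ A, IsTameCurve (timeInterval S T) (mollifiedVelocity φ u)
      (fun s => spatialMaximal (G s)) (2 * η).toNNReal a.1 a.2.1
      (mollifiedFlow φ S T u a.1 a.2.1 a.2.2) :=
    fun a ha => hu.isTameCurve_mollifiedFlow hp hφ ha.1 ha.2.1.1 ha.2.2.1
  have hr0 : ENNReal.ofReal r ≠ 0 := by simpa using hr
  have hfin : ∫⁻ w in timeInterval S T ×ˢ univ, ‖f w‖ₑ ≠ ∞ := by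
    have := hf.eLpNorm_ne_top
    rwa [eLpNorm_one_eq_lintegral_enorm] at this
  have hmain := IsTameCurve.volume_biUnion_le_lintegral (ordConnected_timeInterval S T) hC hη htame
    hr0 ENNReal.ofReal_ne_top hfin fun a ha => by
      have h1 := ha.2.2.2.le
      rw [cylinder_eq_tube, setLAverage_eq] at h1
      exact (ENNReal.le_div_iff_mul_le (Or.inl (htame a ha).volume_tube_ne.1)
        (Or.inl (htame a ha).volume_tube_ne.2)).1 h1
  refine (measure_mono ?_).trans (hmain.trans (le_of_eq ?_))
  · rintro z ⟨hz, hlt⟩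
    obtain ⟨ε, hε, hadm, hav⟩ := lt_cylinderMaximal_iff.1 hlt
    refine mem_iUnion₂.2 ⟨(ε, z), ⟨hε, hz, hadm, hav⟩, ?_, ?_⟩
    · exact ⟨by linarith [pow_pos hε 2], by linarith [pow_pos hε 2]⟩
    · dsimp only
      rw [(hu.isIntegratedCurve_mollifiedFlow hp hφ hε hz.1).2, sub_self, norm_zero]
      exact hε
  · rw [eLpNorm_one_eq_lintegral_enorm, ← mul_assoc, ENNReal.div_eq_inv_mul,
      mul_comm (ENNReal.ofReal r)⁻¹]
    congr 2
    rw [ENNReal.ofReal, Real.toNNReal_mul (by norm_num), Real.toNNReal_pow (by norm_num)]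
    norm_num

/-- The maximal function is lower semicontinuous on the slab. -/
theorem MemL1LocHomSobolev.isOpen_cylinderMaximal_gt (hu : MemL1LocHomSobolev S T p u G)
    (hp : 1 ≤ p) (hφ : IsMollifier φ) {C : ℝ≥0}
    (hC : ControlsIncrements (timeInterval S T) (mollifiedVelocity φ u)
      (fun s => spatialMaximal (G s)) C)
    (hη : 100 * C * (2 * η).toNNReal ≤ 1) {q : ℝ≥0∞} (hq : 1 ≤ q)
    (hM : eLpNorm (fun z : ℝ × Space d => spatialMaximal (G z.1) z.2) q
      (volume.restrict (slab d S T)) < ∞) {q' : ℝ≥0∞} (hq' : 1 ≤ q')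
    (hf : MemLp f q' (volume.restrict (slab d S T))) (r : ℝ≥0∞) :
    IsOpen {z ∈ slab d S T | r < cylinderMaximal φ S T u G η f z} := by
  rw [isOpen_iff_mem_nhds]
  rintro z ⟨hz, hlt⟩
  obtain ⟨ε, hε, hadm, hav⟩ := lt_cylinderMaximal_iff.1 hlt
  have htame := hu.isTameCurve_mollifiedFlow hp hφ hε hz.1 hadm
  have hlim : ∀ h : ℝ × Space d → ℝ≥0∞, AEMeasurable h (volume.restrict (slab d S T)) →
      (∀ E ⊆ slab d S T, volume E < ∞ → ∫⁻ w in E, h w < ∞) →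
      Tendsto (fun z' => ∫⁻ w in cylinder φ S T u (shrunkRadius ε z.1 z'.1) z', h w) (𝓝 z)
        (𝓝 (∫⁻ w in cylinder φ S T u ε z, h w)) := by
    intro h hh hfin
    simp_rw [cylinder_eq_tube]
    exact IsTameCurve.tendsto_lintegral_tube (X := fun ε z => mollifiedFlow φ S T u ε z.1 z.2)
      (isOpen_timeInterval S T) (ordConnected_timeInterval S T) hC hη
      (fun ε hε z hz => hu.isIntegratedCurve_mollifiedFlow hp hφ hε hz) htame hh hfin
  have hfinite : ∀ (h : ℝ × Space d → ℝ≥0∞) (q : ℝ≥0∞), 1 ≤ q →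
      eLpNorm h q (volume.restrict (slab d S T)) < ∞ →
      ∀ E ⊆ slab d S T, volume E < ∞ → ∫⁻ w in E, h w < ∞ := by
    intro h q hq hh E hE hEv
    have hEv' : volume.restrict (slab d S T) E < ∞ :=
      (Measure.restrict_apply_le _ _).trans_lt hEv
    have := setLIntegral_lt_top_of_eLpNorm_lt_top hq hh hEv'
    rwa [Measure.restrict_restrict_of_subset hE] at this
  -- The constant function gives convergence of volumes, so averages converge as well as integrals.
  have hvol := hlim (fun _ => 1) aemeasurable_const fun E _ hE => by simpa using hE
  simp only [setLIntegral_const, one_mul] at hvol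
  have hne := htame.volume_tube_ne
  rw [← cylinder_eq_tube] at hne
  have havg : ∀ h : ℝ × Space d → ℝ≥0∞, AEMeasurable h (volume.restrict (slab d S T)) →
      (∀ E ⊆ slab d S T, volume E < ∞ → ∫⁻ w in E, h w < ∞) →
      Tendsto (fun z' => laverage (volume.restrict
        (cylinder φ S T u (shrunkRadius ε z.1 z'.1) z')) h) (𝓝 z)
        (𝓝 (laverage (volume.restrict (cylinder φ S T u ε z)) h)) := by
    intro h hh hfin
    simp_rw [setLAverage_eq]
    exact ENNReal.Tendsto.div (hlim h hh hfin) (Or.inr hne.1) hvol (Or.inl hne.2)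
  have h1 := havg (fun w => ‖f w‖ₑ) hf.1.enorm (hfinite _ q' hq' (by
    rw [eLpNorm_enorm]; exact hf.eLpNorm_lt_top))
  have h2 := havg (fun w => spatialMaximal (G w.1) w.2)
    (aemeasurable_spatialMaximal hu.aestronglyMeasurable_grad) (hfinite _ q hq hM)
  have het := tendsto_shrunkRadius hε.le z
  have h3 : Tendsto (fun z' : ℝ × Space d => ENNReal.ofReal (shrunkRadius ε z.1 z'.1 ^ 2)) (𝓝 z)
      (𝓝 (ENNReal.ofReal (ε ^ 2))) := ENNReal.tendsto_ofReal (het.pow 2)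
  have h4 := ENNReal.Tendsto.mul h3 (Or.inl (by simpa using hε.ne')) h2
    (Or.inr ENNReal.ofReal_ne_top)
  have hzself : z.1 ∈ lifespan ε z.1 := ⟨by linarith [pow_pos hε 2], by linarith [pow_pos hε 2]⟩
  filter_upwards [h1.eventually (lt_mem_nhds hav), h4.eventually (gt_mem_nhds hadm.2),
    het.eventually (lt_mem_nhds hε), (isOpen_slab d S T).mem_nhds hz,
    continuous_fst.continuousAt.eventually (isOpen_Ioo.mem_nhds hzself)] with z' h5 h6 h7 h8 h9
  refine ⟨h8, lt_cylinderMaximal_iff.2 ⟨_, h7, ⟨?_, h6⟩, h5⟩⟩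
  exact (lifespan_shrunkRadius_subset
    (abs_le.2 ⟨by linarith [h9.1], by linarith [h9.2]⟩)).trans hadm.1

end CylinderMaximal

end SkewedCylinder

/-! ### The main theorem -/

open SkewedCylinder in
theorem mainTheorem1 (d : ℕ) (hd : 1 ≤ d) (φ : Space d → ℝ) (hφ : IsMollifier φ) :
    ∃ η₀ : ℝ, 0 < η₀ ∧ ∃ (C₁ : ℝ≥0) (C : ℝ≥0∞ → ℝ≥0),
      ∀ η : ℝ, 0 < η → η < η₀ →
      ∀ (S T : EReal), S < T →
      ∀ (u : ℝ → Space d → Space d) (G : ℝ → Space d → Space d →L[ℝ] Space d),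
        (∃ p : ℝ≥0∞, 1 ≤ p ∧ MemL1LocHomSobolev S T p u G) →
        DivergenceFree S T G →
        (∃ q : ℝ≥0∞, 1 ≤ q ∧
          eLpNorm (fun z : ℝ × Space d => spatialMaximal (G z.1) z.2) q
            (volume.restrict (slab d S T)) < ∞) →
        -- measurability of the maximal function
        (∀ p : ℝ≥0∞, 1 ≤ p → ∀ f : ℝ × Space d → ℝ, MemLp f p (volume.restrict (slab d S T)) →
          AEMeasurable (cylinderMaximal φ S T u G η f) (volume.restrict (slab d S T))) ∧
        -- strong type `(∞, ∞)` with constant one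
        (∀ f : ℝ × Space d → ℝ, MemLp f ∞ (volume.restrict (slab d S T)) →
          eLpNorm (cylinderMaximal φ S T u G η f) ∞ (volume.restrict (slab d S T))
            ≤ eLpNorm f ∞ (volume.restrict (slab d S T))) ∧
        -- weak type `(1, 1)`
        (∀ f : ℝ × Space d → ℝ, MemLp f 1 (volume.restrict (slab d S T)) →
          ∀ r : ℝ, 0 < r →
            volume {z ∈ slab d S T | ENNReal.ofReal r < cylinderMaximal φ S T u G η f z}
              ≤ (C₁ : ℝ≥0∞) / ENNReal.ofReal r * eLpNorm f 1 (volume.restrict (slab d S T))) ∧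
        -- strong type `(p, p)`
        (∀ p : ℝ≥0∞, 1 < p → ∀ f : ℝ × Space d → ℝ,
          MemLp f p (volume.restrict (slab d S T)) →
          eLpNorm (cylinderMaximal φ S T u G η f) p (volume.restrict (slab d S T))
            ≤ (C p : ℝ≥0∞) * eLpNorm f p (volume.restrict (slab d S T))) := by
  obtain ⟨K, hK⟩ := MemL1LocHomSobolev.exists_controlsIncrements hφ
  -- Interpolation constants are fixed before the measure and the operator, so that they do not
  -- depend on `S`, `T`, `u` or `η`.
  have hinterp : ∀ p : ℝ≥0∞, ∃ C : ℝ≥0, 1 < p → p ≠ ∞ →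
      ∀ (μ : Measure (ℝ × Space d)) (M : (ℝ × Space d → ℝ) → ℝ × Space d → ℝ≥0∞),
      (∀ f : ℝ × Space d → ℝ, MemLp f 1 μ → ∀ r : ℝ, 0 < r →
        μ {z | ENNReal.ofReal r < M f z} ≤
          ((9 * 100 ^ d : ℝ≥0) : ℝ≥0∞) / ENNReal.ofReal r * eLpNorm f 1 μ) →
      (∀ (f : ℝ × Space d → ℝ) (r : ℝ), 0 < r → ∀ᵐ z ∂μ,
        M f z ≤ M ({z | r < 2 * ‖f z‖}.indicator f) z + ENNReal.ofReal (r / 2)) →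
      ∀ f : ℝ × Space d → ℝ, MemLp f (ENNReal.ofReal p.toReal) μ → AEMeasurable (M f) μ →
        ∫⁻ z, M f z ^ p.toReal ∂μ ≤ C * ∫⁻ z, ‖f z‖ₑ ^ p.toReal ∂μ := by
    intro p
    by_cases hp : 1 < p ∧ p ≠ ∞
    · have hp1 : 1 < p.toReal := by
        rw [← ENNReal.toReal_one]
        exact (ENNReal.toReal_lt_toReal ENNReal.one_ne_top hp.2).2 hp.1
      obtain ⟨C, hC⟩ := exists_lintegral_rpow_le_of_weak_type (α := ℝ × Space d) (9 * 100 ^ d) hp1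
      exact ⟨C, fun _ _ => hC⟩
    · exact ⟨0, fun h1 h2 => absurd ⟨h1, h2⟩ hp⟩
  choose D hD using hinterp
  -- This threshold forces `100 K (2 η) ≤ 1`; the summand `1` keeps the denominator positive when `K
  -- = 0`.
  refine ⟨1 / (200 * K + 1), by positivity, 9 * 100 ^ d,
    fun p => if p = ∞ then 1 else D p ^ (1 / p.toReal), ?_⟩
  rintro η hη hη₀ S T - u G ⟨p₀, hp₀, hu⟩ - ⟨q, hq, hM⟩
  have hC := hK S T p₀ u G hu
  have hsmall : 100 * K * (2 * η).toNNReal ≤ 1 := by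
    rw [← NNReal.coe_le_coe]
    push_cast
    rw [Real.coe_toNNReal _ (by positivity)]
    rw [lt_div_iff₀ (by positivity)] at hη₀
    linarith
  have hmeas : ∀ p : ℝ≥0∞, 1 ≤ p → ∀ f : ℝ × Space d → ℝ,
      MemLp f p (volume.restrict (slab d S T)) →
      AEMeasurable (cylinderMaximal φ S T u G η f) (volume.restrict (slab d S T)) := by
    intro p hp f hf
    have hs := (isOpen_slab d S T).measurableSet
    rw [← aemeasurable_indicator_iff hs]
    refine (measurable_of_Ioi fun r => ?_).aemeasurable
    convert! (hu.isOpen_cylinderMaximal_gt hp₀ hφ hC hsmall hq hM hp hf r).measurableSet using 1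
    ext z
    by_cases hz : z ∈ slab d S T <;> simp [hz]
  have hweak := fun (f : ℝ × Space d → ℝ) (hf : MemLp f 1 (volume.restrict (slab d S T)))
    (r : ℝ) (hr : 0 < r) => hu.volume_cylinderMaximal_gt_le hp₀ hφ hC hsmall hf hr
  refine ⟨hmeas, fun f _ => eLpNorm_top_cylinderMaximal_le, hweak, fun p hp f hf => ?_⟩
  rcases eq_or_ne p ∞ with rfl | hpt
  · simpa using eLpNorm_top_cylinderMaximal_le
  have hp0 : p ≠ 0 := (zero_lt_one.trans hp).ne'
  have hpos : 0 < p.toReal := ENNReal.toReal_pos hp0 hpt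
  have h := hD p hp hpt (volume.restrict (slab d S T)) (cylinderMaximal φ S T u G η)
    (fun f hf r hr => by
      rw [Measure.restrict_apply' (isOpen_slab d S T).measurableSet, inter_comm]
      exact hweak f hf r hr)
    (fun f r _ => ae_of_all _ (cylinderMaximal_le_indicator_add r)) f
    (by rwa [ENNReal.ofReal_toReal hpt]) (hmeas p hp.le f hf)
  beta_reduce
  rw [if_neg hpt, eLpNorm_eq_lintegral_rpow_enorm_toReal hp0 hpt,
    eLpNorm_eq_lintegral_rpow_enorm_toReal hp0 hpt,
    ENNReal.coe_rpow_of_nonneg _ (by positivity), ← ENNReal.mul_rpow_of_nonneg _ _ (by positivity)]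
  refine ENNReal.rpow_le_rpow ?_ (by positivity)
  simpa only [enorm_eq_self] using h
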